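/- Let $t\ge 1$ be an integer and let $p,m\in\mathbb Z$. For $\tau$ in the upper half-plane and $x\in\mathbb Q$ write $q^x:=e^{2\pi i x\tau}$. Put $\operatorname{sg}(r)=1$ for $r\ge 0$, $\operatorname{sg}(r)=-1$ for $r<0$, and $\operatorname{sg}(r,s)=\tfrac12(\operatorname{sg}(r)+\operatorname{sg}(s))$. Define $$\theta_{p,m}(\tau):=\sum_{\substack{r,s\in\mathbb Z\\ r\not\equiv s\ (\mathrm{mod}\ 2)}}\operatorname{sg}(r,s)\,(-1)^{\frac{r-s-1}{2}}\,q^{\frac18r^2+\frac{4t-1}{4}rs+\frac18s^2+\frac{p+m}{2}r+\frac{p-m}{2}s},\qquad \theta^*_{p,m}(\tau):=q^{-\frac{m^2}{2(2t-1)}+\frac{p^2}{4t}}\,\theta_{p,m}(\tau).$$ Then the series $\theta_{p,m}(\tau)$ converges absolutely for every $\tau$ in the upper half-plane, and $\theta^*_{p,m}$ is a holomorphic modular form of weight $1$ on some subgroup of finite index of $\operatorname{SL}_2(\mathbb Z)$; that is, it is holomorphic on the upper half-plane, satisfies $\theta^*_{p,m}\bigl(\tfrac{a\tau+b}{c\tau+d}\bigr)=(c\tau+d)\,\theta^*_{p,m}(\tau)$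 for all $\begin{pmatrix}a&b\\c&d\end{pmatrix}$ in that subgroup, and is bounded at all cusps. -/

import Mathlib

noncomputable section

/-- The rational power `q ^ x` of `q = exp (2πiτ)`, read as the function `exp (2πi x τ)` of `τ`. -/
def qPow (τ : UpperHalfPlane) (x : ℝ) : ℂ :=
  Complex.exp (2 * (Real.pi : ℂ) * Complex.I * (x : ℂ) * (τ : ℂ))

/-- The sign with the convention that the sign of `0` is `1`. -/
def sg (r : ℤ) : ℝ := if 0 ≤ r then 1 else -1

/-- `sg(r, s) = (sg(r) + sg(s)) / 2`. -/
def sgPair (r s : ℤ) : ℝ := (sg r + sg s) / 2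

/-- The exponent `r²/8 + (4t-1)rs/4 + s²/8 + (p+m)r/2 + (p-m)s/2`. -/
def thetaExponent (t : ℕ) (p m r s : ℤ) : ℝ :=
  (r : ℝ) ^ 2 / 8 + (4 * (t : ℝ) - 1) / 4 * (r : ℝ) * (s : ℝ) + (s : ℝ) ^ 2 / 8
    + ((p : ℝ) + (m : ℝ)) / 2 * (r : ℝ) + ((p : ℝ) - (m : ℝ)) / 2 * (s : ℝ)

/-- The index set: pairs of integers `(r, s)` with `r ≢ s (mod 2)`. -/
abbrev ThetaIndex : Type := {x : ℤ × ℤ // ¬ x.1 ≡ x.2 [ZMOD 2]}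

/-- The term of `θ_{p,m}` at `(r, s)`. The number `r - s - 1` is even on the index set, so the
integer division in the exponent of `-1` is exact. -/
def thetaTerm (t : ℕ) (p m : ℤ) (τ : UpperHalfPlane) (x : ThetaIndex) : ℂ :=
  (sgPair x.1.1 x.1.2 : ℂ) * (-1 : ℂ) ^ ((x.1.1 - x.1.2 - 1) / 2)
    * qPow τ (thetaExponent t p m x.1.1 x.1.2)

/-- The indefinite binary theta series `θ_{p,m}` as a function of `τ`. -/
def theta (t : ℕ) (p m : ℤ) (τ : UpperHalfPlane) : ℂ :=
  ∑' x : ThetaIndex, thetaTerm t p m τ x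

/-- The normalized series `θ*_{p,m} = q ^ (-m²/(2(2t-1)) + p²/(4t)) θ_{p,m}`. -/
def thetaStar (t : ℕ) (p m : ℤ) (τ : UpperHalfPlane) : ℂ :=
  qPow τ (-((m : ℝ) ^ 2 / (2 * (2 * (t : ℝ) - 1))) + (p : ℝ) ^ 2 / (4 * (t : ℝ)))
    * theta t p m τ

end

/-! ### Finiteness of the image of the Weil representation -/

section

open Finset

/-! The coordinates k = t(r+s)+p and l = (2t-1)(r-s)-2m turn the normalised exponent into k²/(4t) -
l²/(4(4t-2)), a form of signature (1,1). The condition r ≢ s (mod 2) and the sign (-1)^((r-s-1)/2)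
become a function on the discriminant group of this form (`thetaFunction`).

Any function φ on this group has a Siegel theta kernel `siegelTheta`, depending on a hyperbolic
angle u. By Poisson summation it transforms with weight one under S and T, while φ moves by the
Fourier transform and by multiplication with the quadratic character (`siegelTheta_inv`,
`siegelTheta_vadd_one`). Integrating over a compact segment -U ≤ u ≤ U preserves this. Term by term
the integral is a holomorphic power of q times a sum of two error functions (`integral_siegelTerm`).
For U = `halfLength t` their arguments are positive multiples of r and s, up to constant shifts, so
the integral is θ* with each sign replaced by an error function.

The replacement changes nothing. The discrepancy between error function and sign in the r-term
depends on r alone, and the reflection that fixes r and preserves the exponent reverses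
(-1)^((r-s-1)/2), so the discrepancies cancel in pairs; the same holds for s. Hence θ* equals the
integral (`thetaStar_eq_thetaIntegral`): holomorphic as a q-series, modular as a theta integral.

The two operators on φ generate a finite monoid (`finite_weilMonoid`). So θ* has finitely many
translates under the modular group and its stabiliser has finite index. Each translate is again a
theta integral, hence bounded at i∞, and this gives boundedness at all cusps. -/

/-- A finite quadratic module: a finite abelian group with a nondegenerate symmetric bicharacter `b`
and a quadratic function `q` refining its inverse, all values being `M`-th roots of unity. The number
`c` normalises the Fourier transform. -/
structure FiniteQuadraticModule (G : Type*) [AddCommGroup G] [Fintype G] [DecidableEq G] where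
  b : G → G → ℂ
  q : G → ℂ
  c : ℂ
  M : ℕ
  M_pos : 0 < M
  b_add : ∀ x y z, b (x + y) z = b x z * b y z
  b_symm : ∀ x y, b x y = b y x
  b_sum : ∀ x, ∑ y, b x y = if x = 0 then (Fintype.card G : ℂ) else 0
  b_pow : ∀ x y, b x y ^ M = 1
  q_pow : ∀ x, q x ^ M = 1
  q_add : ∀ x y, q (x + y) * b x y = q x * q y
  c_sq : c ^ 2 * Fintype.card G = 1

namespace FiniteQuadraticModule

variable {G : Type*} [AddCommGroup G] [Fintype G] [DecidableEq G] (D : FiniteQuadraticModule G)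

lemma b_ne (x y : G) : D.b x y ≠ 0 := fun h => by
  simpa [h, D.M_pos.ne'] using D.b_pow x y

lemma q_ne (x : G) : D.q x ≠ 0 := fun h => by
  simpa [h, D.M_pos.ne'] using D.q_pow x

lemma b_zero_left (y : G) : D.b 0 y = 1 := by
  have h := D.b_add 0 0 y
  rw [add_zero] at h
  exact (mul_right_cancel₀ (D.b_ne 0 y) (by rw [one_mul]; exact h)).symm

lemma b_zero_right (y : G) : D.b y 0 = 1 := by rw [D.b_symm, D.b_zero_left]

lemma b_add_right (x y z : G) : D.b x (y + z) = D.b x y * D.b x z := by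
  rw [D.b_symm, D.b_add, D.b_symm y, D.b_symm z]

/-- The Fourier transform. -/
def fourier : Module.End ℂ (G → ℂ) where
  toFun φ x := D.c * ∑ y, φ y * D.b x y
  map_add' φ ψ := by ext x; simp [add_mul, sum_add_distrib, mul_add]
  map_smul' r φ := by ext x; simp [mul_sum, mul_assoc, mul_left_comm]

/-- Multiplication by the quadratic function. -/
def quad : Module.End ℂ (G → ℂ) where
  toFun φ x := D.q x * φ x
  map_add' φ ψ := by ext x; simp [mul_add]
  map_smul' r φ := by ext x; simp [mul_left_comm]

/-- Elements of the Heisenberg group. -/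
def heis (ζ : ℂ) (a d : G) : Module.End ℂ (G → ℂ) where
  toFun φ x := ζ * D.b d x * φ (x + a)
  map_add' φ ψ := by ext x; simp [mul_add]
  map_smul' r φ := by ext x; simp [mul_left_comm]

lemma fourier_apply (φ : G → ℂ) (x : G) : D.fourier φ x = D.c * ∑ y, φ y * D.b x y := rfl
lemma quad_apply (φ : G → ℂ) (x : G) : D.quad φ x = D.q x * φ x := rfl
lemma heis_apply (ζ : ℂ) (a d : G) (φ : G → ℂ) (x : G) :
    D.heis ζ a d φ x = ζ * D.b d x * φ (x + a) := rfl

lemma fourier_fourier (φ : G → ℂ) (x : G) : D.fourier (D.fourier φ) x = φ (-x) := by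
  have key : ∀ z : G, ∑ y, D.b y z * D.b x y = if z = -x then (Fintype.card G : ℂ) else 0 := by
    intro z
    have : ∀ y, D.b y z * D.b x y = D.b (z + x) y := fun y => by rw [D.b_symm y z, D.b_add]
    simp_rw [this, D.b_sum, add_eq_zero_iff_eq_neg]
  calc D.fourier (D.fourier φ) x
      = D.c ^ 2 * ∑ y, ∑ z, φ z * (D.b y z * D.b x y) := by
        simp only [fourier_apply, mul_sum, sum_mul]
        refine sum_congr rfl fun y _ => sum_congr rfl fun z _ => by ring
    _ = D.c ^ 2 * ∑ z, φ z * ∑ y, D.b y z * D.b x y := by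
        rw [sum_comm]; simp_rw [mul_sum]
    _ = φ (-x) := by
        simp_rw [key]
        simp only [mul_ite, mul_zero, sum_ite_eq', mem_univ, if_true]
        rw [mul_left_comm, D.c_sq, mul_one]

lemma fourier_pow_four : D.fourier ^ 4 = 1 := by
  refine LinearMap.ext fun φ => ?_
  ext x
  simp only [pow_succ, pow_zero, one_mul, Module.End.mul_apply, Module.End.one_apply]
  rw [D.fourier_fourier, D.fourier_fourier, neg_neg]

lemma quad_pow_M : D.quad ^ D.M = 1 := by
  have : ∀ n : ℕ, ∀ φ x, (D.quad ^ n) φ x = D.q x ^ n * φ x := by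
    intro n
    induction n with
    | zero => intro φ x; simp
    | succ n ih => intro φ x; rw [pow_succ', Module.End.mul_apply, quad_apply, ih]; ring
  refine LinearMap.ext fun φ => ?_
  ext x
  rw [this, D.q_pow, one_mul, Module.End.one_apply]

/-- The Fourier transform exchanges translations and modulations. Together with `quad_mul_heis` this
lets Weil operators move past Heisenberg operators without leaving the finite set `heisSet`. -/
lemma fourier_mul_heis (ζ : ℂ) (a d : G) :
    D.fourier * D.heis ζ a d = D.heis (ζ * D.b d (-a)) d (-a) * D.fourier := by
  refine LinearMap.ext fun φ => ?_
  ext x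
  simp only [Module.End.mul_apply, heis_apply, fourier_apply]
  rw [← Equiv.sum_comp (Equiv.addRight (-a))]
  simp only [Equiv.coe_addRight, neg_add_cancel_right, mul_sum]
  refine sum_congr rfl fun y _ => ?_
  rw [D.b_add_right, D.b_add_right, D.b_add, D.b_symm (-a) x]
  ring

lemma quad_mul_heis (ζ : ℂ) (a d : G) :
    D.quad * D.heis ζ a d = D.heis (ζ * (D.q a)⁻¹) a (d + a) * D.quad := by
  refine LinearMap.ext fun φ => ?_
  ext x
  simp only [Module.End.mul_apply, heis_apply, quad_apply]
  have h := D.q_add x a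
  rw [D.b_add, D.b_symm a x]
  have h' : D.q x = D.q (x + a) * D.b x a * (D.q a)⁻¹ := by
    rw [h, mul_inv_cancel_right₀ (D.q_ne a)]
  rw [h']; ring

/-- The finite set of Heisenberg operators. -/
def heisSet : Set (Module.End ℂ (G → ℂ)) :=
  {h | ∃ ζ : ℂ, ζ ^ D.M = 1 ∧ ∃ a d, h = D.heis ζ a d}

lemma finite_roots (n : ℕ) (hn : 0 < n) : {ζ : ℂ | ζ ^ n = 1}.Finite := by
  refine (Polynomial.nthRoots n (1 : ℂ)).toFinset.finite_toSet.subset fun ζ hζ => ?_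
  simpa [Polynomial.mem_nthRoots hn] using hζ

lemma finite_heisSet : D.heisSet.Finite := by
  have := (finite_roots D.M D.M_pos).prod (Set.finite_univ (α := G × G))
  refine (this.image fun x => D.heis x.1 x.2.1 x.2.2).subset ?_
  rintro h ⟨ζ, hζ, a, d, rfl⟩
  exact ⟨(ζ, a, d), ⟨hζ, trivial⟩, rfl⟩

/-- The monoid generated by the two operators of the Weil representation. -/
def weilMonoid : Submonoid (Module.End ℂ (G → ℂ)) := Submonoid.closure {D.fourier, D.quad}

lemma heisSet_stable {g : Module.End ℂ (G → ℂ)} (hg : g ∈ D.weilMonoid) :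
    ∀ h ∈ D.heisSet, ∃ h' ∈ D.heisSet, g * h = h' * g := by
  induction hg using Submonoid.closure_induction with
  | mem x hx =>
    rintro h ⟨ζ, hζ, a, d, rfl⟩
    rcases hx with rfl | rfl
    · exact ⟨_, ⟨_, by rw [mul_pow, hζ, D.b_pow, one_mul], _, _, rfl⟩, D.fourier_mul_heis ζ a d⟩
    · exact ⟨_, ⟨_, by rw [mul_pow, hζ, inv_pow, D.q_pow, inv_one, one_mul], _, _, rfl⟩,
        D.quad_mul_heis ζ a d⟩
  | one => exact fun h hh => ⟨h, hh, by simp⟩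
  | mul x y _ _ ihx ihy =>
    intro h hh
    obtain ⟨h', hh', e⟩ := ihy h hh
    obtain ⟨h'', hh'', e'⟩ := ihx h' hh'
    exact ⟨h'', hh'', by rw [mul_assoc, e, ← mul_assoc, e', mul_assoc]⟩

lemma det_pow_of_mem {g : Module.End ℂ (G → ℂ)} (hg : g ∈ D.weilMonoid) :
    LinearMap.det g ^ (4 * D.M) = 1 := by
  induction hg using Submonoid.closure_induction with
  | mem x hx =>
    rcases hx with rfl | rfl
    · rw [pow_mul, ← map_pow, D.fourier_pow_four, map_one, one_pow]
    · rw [mul_comm, pow_mul, ← map_pow, D.quad_pow_M, map_one, one_pow]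
  | one => simp
  | mul x y _ _ ihx ihy => rw [map_mul, mul_pow, ihx, ihy, one_mul]

/-- Schur's lemma for the Heisenberg group. Modulations fix the delta function at 0, so its image
under L is again supported at 0 by nondegeneracy; translations carry this to every other delta
function. -/
lemma exists_scalar {L : Module.End ℂ (G → ℂ)} (hL : ∀ h ∈ D.heisSet, L * h = h * L) :
    ∃ r : ℂ, L = r • 1 := by
  have hL' : ∀ a d φ x, L (D.heis 1 a d φ) x = D.b d x * L φ (x + a) := fun a d φ x => by
    have := congrArg (fun A : Module.End ℂ (G → ℂ) => A φ x) (hL _ ⟨1, one_pow _, a, d, rfl⟩)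
    simpa only [Module.End.mul_apply, heis_apply, one_mul] using this
  have h0 : ∀ x, x ≠ 0 → L (Pi.single 0 1) x = 0 := by
    intro x hx
    obtain ⟨d, hd⟩ : ∃ d, D.b x d ≠ 1 := by
      by_contra! hcon
      have := D.b_sum x
      simp_rw [hcon, hx] at this
      simp at this
    have e : D.heis 1 0 d (Pi.single 0 1) = Pi.single (0 : G) (1 : ℂ) := by
      ext y
      rw [heis_apply, add_zero]
      by_cases hy : y = 0
      · subst hy; simp [D.b_zero_right]
      · simp [hy]
    have := hL' 0 d (Pi.single 0 1) x
    rw [e, add_zero, D.b_symm] at this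
    by_contra hne
    exact hd (mul_right_cancel₀ hne (by rw [one_mul]; exact this.symm))
  refine ⟨L (Pi.single 0 1) 0, ?_⟩
  refine (Pi.basisFun ℂ G).ext fun i => ?_
  have e : D.heis 1 (-i) 0 (Pi.single 0 1) = Pi.single (i : G) (1 : ℂ) := by
    ext y
    rw [heis_apply, D.b_zero_left]
    by_cases hy : y = i
    · subst hy; simp
    · rw [Pi.single_eq_of_ne hy, Pi.single_eq_of_ne (by rwa [← sub_eq_add_neg, sub_ne_zero])]; simp
  ext x
  rw [Pi.basisFun_apply, ← e, hL', D.b_zero_left, one_mul, e]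
  by_cases hx : x = i
  · subst hx; simp
  · rw [h0 _ (by rwa [← sub_eq_add_neg, sub_ne_zero])]; simp [hx]

/-- An operator is determined up to a scalar by how it intertwines the finitely many Heisenberg
operators: if g and u do so alike, u⁻¹g commutes with all of them and `exists_scalar` applies. The
determinants are roots of unity of bounded order, which leaves finitely many scalars. -/
theorem finite_weilMonoid : (D.weilMonoid : Set (Module.End ℂ (G → ℂ))).Finite := by
  let f : Module.End ℂ (G → ℂ) → Set (Module.End ℂ (G → ℂ) × Module.End ℂ (G → ℂ)) :=
    fun g => {p | p ∈ D.heisSet ×ˢ D.heisSet ∧ g * p.1 = p.2 * g}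
  refine Set.Finite.of_finite_fibers f ?_ ?_
  · refine (D.finite_heisSet.prod D.finite_heisSet).finite_subsets.subset ?_
    rintro _ ⟨g, -, rfl⟩
    exact fun p hp => hp.1
  · rintro _ ⟨g₀, hg₀, rfl⟩
    -- Scaling by r multiplies the determinant by r ^ |G|, and determinants have order dividing 4M;
    -- hence this exponent for r.
    have hpos : 0 < Fintype.card G * (4 * D.M) :=
      Nat.mul_pos Fintype.card_pos (Nat.mul_pos (by norm_num) D.M_pos)
    refine ((finite_roots _ hpos).image fun r => r • g₀).subset ?_
    rintro g ⟨hg, hfg⟩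
    have hdet₀ := D.det_pow_of_mem hg₀
    have hunit : IsUnit (LinearMap.det g₀) := by
      refine IsUnit.mk0 _ fun h => ?_
      rw [h, zero_pow (by have := D.M_pos; omega)] at hdet₀
      exact zero_ne_one hdet₀
    obtain ⟨u, rfl⟩ := (LinearMap.isUnit_iff_isUnit_det g₀).mpr hunit
    obtain ⟨r, hr⟩ := D.exists_scalar (L := ↑u⁻¹ * g) fun h hh => by
      obtain ⟨h', hh', e⟩ := D.heisSet_stable hg h hh
      have hm : (h, h') ∈ f g := ⟨⟨hh, hh'⟩, e⟩
      have hm' : (h, h') ∈ f u := by rw [← show f g = f u from hfg]; exact hm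
      have e' : (u : Module.End ℂ (G → ℂ)) * h = h' * u := hm'.2
      have e'' : (↑u⁻¹ : Module.End ℂ (G → ℂ)) * h' = h * ↑u⁻¹ := by
        rw [Units.inv_mul_eq_iff_eq_mul, ← mul_assoc, e', Units.mul_inv_cancel_right]
      rw [mul_assoc, e, ← mul_assoc, e'', mul_assoc]
    have hgr : g = r • (u : Module.End ℂ (G → ℂ)) := by
      rw [Units.inv_mul_eq_iff_eq_mul] at hr
      rw [hr, mul_smul_comm, mul_one]
    refine ⟨r, ?_, hgr.symm⟩
    have hdet := D.det_pow_of_mem hg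
    rw [hgr, LinearMap.det_smul, mul_pow, hdet₀, mul_one, Module.finrank_pi, ← pow_mul] at hdet
    exact hdet

end FiniteQuadraticModule

end

/-! ### Binary Gaussian sums and Poisson summation for complex quadratic forms -/

section

open Complex Real

lemma summable_exp_neg_sq_add_abs {c : ℝ} (hc : 0 < c) (S : ℝ) :
    Summable fun x : ℤ × ℤ =>
      Real.exp (-c * ((x.1 : ℝ) ^ 2 + (x.2 : ℝ) ^ 2) + S * (|(x.1 : ℝ)| + |(x.2 : ℝ)|)) := by
  have h1 : Summable fun n : ℤ => Real.exp (-c * (n : ℝ) ^ 2 + S * |(n : ℝ)|) := by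
    have := summable_pow_mul_jacobiTheta₂_term_bound (S / (2 * π)) (div_pos hc pi_pos) 0
    refine this.congr fun n => ?_
    have hpi := pi_ne_zero
    rw [pow_zero, one_mul]
    congr 1
    push_cast
    field_simp
    ring
  refine (h1.mul_of_nonneg h1 (fun _ => (Real.exp_pos _).le) fun _ => (Real.exp_pos _).le).congr
    fun x => ?_
  rw [← Real.exp_add]
  ring_nf

lemma exists_pos_le_quadratic {P R S : ℝ} (hP : 0 < P) (hdet : R ^ 2 < P * S) :
    ∃ c > 0, ∀ x y : ℝ, c * (x ^ 2 + y ^ 2) ≤ P * x ^ 2 + 2 * R * x * y + S * y ^ 2 := by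
  have hS : 0 < S := by
    by_contra! h
    nlinarith [sq_nonneg R, mul_nonneg hP.le (neg_nonneg.mpr h)]
  have hPS : 0 < P + S := by linarith
  -- Determinant over trace is λ₁λ₂/(λ₁+λ₂), which lies below both eigenvalues.
  refine ⟨(P * S - R ^ 2) / (P + S), div_pos (by linarith) hPS, fun x y => ?_⟩
  set e := (P * S - R ^ 2) / (P + S) with he
  have he' : e * (P + S) = P * S - R ^ 2 := div_mul_cancel₀ _ hPS.ne'
  have hPe : 0 < P - e := by
    rw [he, sub_pos, div_lt_iff₀ hPS]
    nlinarith [sq_nonneg R, mul_pos hP hP]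
  have key : 0 ≤ (P - e) * (P * x ^ 2 + 2 * R * x * y + S * y ^ 2 - e * (x ^ 2 + y ^ 2)) := by
    have : (P - e) * (P * x ^ 2 + 2 * R * x * y + S * y ^ 2 - e * (x ^ 2 + y ^ 2))
        = ((P - e) * x + R * y) ^ 2 + (e * y) ^ 2 := by
      linear_combination (-y ^ 2) * he'
    rw [this]; positivity
  have := nonneg_of_mul_nonneg_right key hPe
  linarith

/-- The summand of a binary Gaussian sum with a general quadratic polynomial as exponent. -/
noncomputable def gaussTerm (a b c d e f : ℂ) (x : ℤ × ℤ) : ℂ :=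
  cexp (-(a * (x.1 : ℂ) ^ 2 + 2 * b * x.1 * x.2 + c * (x.2 : ℂ) ^ 2) + d * x.1 + e * x.2 + f)

lemma exists_norm_gaussTerm_le {a b c : ℂ} (ha : 0 < a.re) (hdet : b.re ^ 2 < a.re * c.re) (S : ℝ) :
    ∃ u : ℤ × ℤ → ℝ, Summable u ∧ ∀ d e f : ℂ, ‖d‖ ≤ S → ‖e‖ ≤ S → ‖f‖ ≤ S →
      ∀ x, ‖gaussTerm a b c d e f x‖ ≤ u x := by
  obtain ⟨ε, hε, hq⟩ := exists_pos_le_quadratic ha hdet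
  refine ⟨_, (summable_exp_neg_sq_add_abs hε S).mul_left (Real.exp S), fun d e f hd he hf x => ?_⟩
  rw [gaussTerm, Complex.norm_exp, ← Real.exp_add]
  refine Real.exp_le_exp.mpr ?_
  have h := hq x.1 x.2
  have e1 : (a * (x.1 : ℂ) ^ 2 + 2 * b * x.1 * x.2 + c * (x.2 : ℂ) ^ 2).re
      = a.re * (x.1 : ℝ) ^ 2 + 2 * b.re * x.1 * x.2 + c.re * (x.2 : ℝ) ^ 2 := by
    simp [pow_two]
  have e2 : ∀ (z : ℂ) (n : ℤ), ‖z‖ ≤ S → (z * n).re ≤ S * |(n : ℝ)| := fun z n hz => by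
    refine (Complex.re_le_norm _).trans ?_
    rw [norm_mul, Complex.norm_intCast]
    gcongr
  have h1 := e2 d x.1 hd
  have h2 := e2 e x.2 he
  have h3 := (Complex.re_le_norm f).trans hf
  rw [Complex.add_re, Complex.add_re, Complex.add_re, Complex.neg_re, e1]
  linarith

lemma summable_gaussTerm {a b c : ℂ} (ha : 0 < a.re) (hdet : b.re ^ 2 < a.re * c.re)
    (d e f : ℂ) : Summable (gaussTerm a b c d e f) := by
  obtain ⟨u, hu, h⟩ := exists_norm_gaussTerm_le ha hdet (max ‖d‖ (max ‖e‖ ‖f‖))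
  exact hu.of_norm_bounded (h d e f (by simp) (by simp) (by simp))

/-- Termwise differentiation in a direction of parameter space. The term f₂ζ² is allowed because
shifting the centre of a Gaussian linearly in ζ changes its constant term quadratically. -/
lemma hasSum_deriv_gaussTerm {a b c : ℂ} (ha : 0 < a.re) (hdet : b.re ^ 2 < a.re * c.re)
    (d₀ d₁ e₀ e₁ f₀ f₁ f₂ : ℂ) :
    HasSum (fun x : ℤ × ℤ => (d₁ * x.1 + e₁ * x.2 + f₁) * gaussTerm a b c d₀ e₀ f₀ x)
      (deriv (fun ζ : ℂ => ∑' x, gaussTerm a b c (d₀ + d₁ * ζ) (e₀ + e₁ * ζ)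
        (f₀ + f₁ * ζ + f₂ * ζ ^ 2) x) 0) := by
  obtain ⟨u, hu, h⟩ := exists_norm_gaussTerm_le ha hdet
    (max (‖d₀‖ + ‖d₁‖) (max (‖e₀‖ + ‖e₁‖) (‖f₀‖ + ‖f₁‖ + ‖f₂‖)))
  have hder : ∀ (x : ℤ × ℤ) (ζ : ℂ), HasDerivAt (fun ζ : ℂ => gaussTerm a b c (d₀ + d₁ * ζ)
      (e₀ + e₁ * ζ) (f₀ + f₁ * ζ + f₂ * ζ ^ 2) x)
      ((gaussTerm a b c (d₀ + d₁ * ζ) (e₀ + e₁ * ζ) (f₀ + f₁ * ζ + f₂ * ζ ^ 2) x) *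
        (d₁ * x.1 + e₁ * x.2 + (f₁ + f₂ * (2 * ζ)))) ζ := by
    intro x ζ
    unfold gaussTerm
    refine HasDerivAt.cexp ?_
    have hid := hasDerivAt_id' ζ
    have h1 := ((hid.const_mul d₁).const_add d₀).mul_const (x.1 : ℂ)
    have h2 := ((hid.const_mul e₁).const_add e₀).mul_const (x.2 : ℂ)
    have h3 := ((hid.const_mul f₁).const_add f₀).add ((hid.pow 2).const_mul f₂)
    refine (((h1.const_add (-(a * (x.1 : ℂ) ^ 2 + 2 * b * x.1 * x.2 + c * (x.2 : ℂ) ^ 2))).add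
      h2).add h3).congr_deriv ?_
    simp
  have hn : ∀ (p r ζ : ℂ), ‖ζ‖ < 1 → ‖p + r * ζ‖ ≤ ‖p‖ + ‖r‖ := fun p r ζ hζ => by
    refine (norm_add_le _ _).trans ?_
    rw [norm_mul]
    nlinarith [norm_nonneg r]
  have := hasSum_deriv_of_summable_norm hu (U := Metric.ball 0 1) (z := (0 : ℂ))
    (F := fun x ζ => gaussTerm a b c (d₀ + d₁ * ζ) (e₀ + e₁ * ζ) (f₀ + f₁ * ζ + f₂ * ζ ^ 2) x)
    (fun x ζ _ => (hder x ζ).differentiableAt.differentiableWithinAt) Metric.isOpen_ball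
    (fun x ζ hζ => by
      rw [mem_ball_zero_iff] at hζ
      refine h _ _ _ ((hn _ _ _ hζ).trans (le_max_left _ _))
        ((hn _ _ _ hζ).trans ((le_max_left _ _).trans (le_max_right _ _))) ?_ x
      refine le_trans ?_ ((le_max_right _ _).trans (le_max_right _ _))
      refine (norm_add_le _ _).trans (add_le_add (hn _ _ _ hζ) ?_)
      rw [norm_mul, norm_pow]
      exact mul_le_of_le_one_right (norm_nonneg _) (pow_le_one₀ (norm_nonneg _) hζ.le))
    (Metric.mem_ball_self one_pos)
  refine this.congr_fun ?_
  intro x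
  rw [(hder x 0).deriv]
  simp [mul_comm]

/-- Data of a complex binary quadratic form with real middle coefficient and real determinant. -/
structure IsThetaForm (A C : ℂ) (B Δ : ℝ) : Prop where
  A_pos : 0 < A.re
  C_pos : 0 < C.re
  Δ_pos : 0 < Δ
  det_re : B ^ 2 < A.re * C.re
  det_eq : A * C = Δ + (B : ℂ) ^ 2

namespace IsThetaForm

variable {A C : ℂ} {B Δ : ℝ} (h : IsThetaForm A C B Δ)
include h

lemma C_ne : C ≠ 0 := fun h0 => by simpa [h0] using h.C_pos

lemma inv_re_pos : 0 < (C⁻¹).re := by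
  rw [Complex.inv_re]
  exact div_pos h.C_pos (normSq_pos.mpr h.C_ne)

/-- This is the positivity needed for absolute convergence of the mixed sum, in which Poisson
summation has been applied to one variable only. -/
lemma im_lt : B ^ 2 * C.im ^ 2 < Δ * C.re ^ 2 := by
  have h1 := congrArg Complex.re h.det_eq
  have h2 := congrArg Complex.im h.det_eq
  have e : ((Δ : ℂ) + (B : ℂ) ^ 2) = ((Δ + B ^ 2 : ℝ) : ℂ) := by push_cast; rfl
  rw [e, Complex.ofReal_re, Complex.mul_re] at h1
  rw [e, Complex.ofReal_im, Complex.mul_im] at h2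
  have h3 : A.re * (C.re ^ 2 + C.im ^ 2) = (Δ + B ^ 2) * C.re := by
    linear_combination C.re * h1 + C.im * h2
  have hC := h.C_pos
  have h4 : 0 < C.re ^ 2 + C.im ^ 2 := by positivity
  have h5 := mul_lt_mul_of_pos_right h.det_re h4
  have h6 : A.re * C.re * (C.re ^ 2 + C.im ^ 2) = (Δ + B ^ 2) * C.re ^ 2 := by
    linear_combination C.re * h3
  linarith

/-- One-dimensional Poisson summation is applied in the second variable, where the coefficient is C,
and then in the first, where completing the square leaves Δ/C. Absolute convergence of all three
double sums permits the interchanges. -/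
theorem tsum_gauss (z w : ℂ) :
    ∑' x : ℤ × ℤ, cexp (-π * (A * (x.1 : ℂ) ^ 2 + 2 * B * x.1 * x.2 + C * (x.2 : ℂ) ^ 2)
        + 2 * π * I * (x.1 * z + x.2 * w))
      = 1 / (√Δ : ℂ) * ∑' x : ℤ × ℤ, cexp (-π / Δ * (C * (x.1 - z) ^ 2
          - 2 * B * (x.1 - z) * (x.2 - w) + A * (x.2 - w) ^ 2)) := by
  have hC := h.C_ne
  have hΔ : (Δ : ℂ) ≠ 0 := by exact_mod_cast h.Δ_pos.ne'
  have hpi : (0 : ℝ) < π := pi_pos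
  have hinv := h.inv_re_pos
  -- first sum
  have s1 : Summable fun x : ℤ × ℤ => cexp (-π * (A * (x.1 : ℂ) ^ 2 + 2 * B * x.1 * x.2
      + C * (x.2 : ℂ) ^ 2) + 2 * π * I * (x.1 * z + x.2 * w)) := by
    refine (summable_gaussTerm (a := π * A) (b := π * B) (c := π * C) ?_ ?_ (2 * π * I * z)
      (2 * π * I * w) 0).congr fun x => ?_
    · rw [re_ofReal_mul]; exact mul_pos hpi h.A_pos
    · simp only [re_ofReal_mul, Complex.ofReal_re]
      nlinarith [mul_lt_mul_of_pos_left h.det_re (mul_pos hpi hpi)]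
    · rw [gaussTerm]; congr 1; ring
  -- intermediate sum
  have s2 : Summable fun x : ℤ × ℤ => cexp (-π * A * (x.1 : ℂ) ^ 2 + 2 * π * I * x.1 * z
      - π / C * ((x.2 : ℂ) - w - I * B * x.1) ^ 2) := by
    have e1 : (π * Δ * C⁻¹ : ℂ).re = π * Δ * (C.re / normSq C) := by
      rw [← Complex.ofReal_mul, re_ofReal_mul, Complex.inv_re]
    have e2 : (π * C⁻¹ : ℂ).re = π * (C.re / normSq C) := by
      rw [re_ofReal_mul, Complex.inv_re]
    have e3 : (-(π * B : ℝ) * (I * C⁻¹) : ℂ).re = -(π * B * (C.im / normSq C)) := by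
      rw [neg_mul, Complex.neg_re, re_ofReal_mul, Complex.I_mul_re, Complex.inv_im]
      ring
    have hn : 0 < normSq C := normSq_pos.mpr hC
    refine (summable_gaussTerm (a := π * Δ * C⁻¹) (b := -(π * B : ℝ) * (I * C⁻¹)) (c := π * C⁻¹)
      ?_ ?_ (2 * π * I * z - 2 * π * C⁻¹ * I * B * w) (2 * π * C⁻¹ * w)
      (-π * C⁻¹ * w ^ 2)).congr fun x => ?_
    · rw [e1]; have := h.C_pos; have := h.Δ_pos; positivity
    · rw [e1, e2, e3]
      have : 0 < (π / normSq C) ^ 2 := by positivity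
      have := mul_lt_mul_of_pos_left h.im_lt this
      calc _ = (π / normSq C) ^ 2 * (B ^ 2 * C.im ^ 2) := by ring
        _ < _ := this
        _ = _ := by ring
    · rw [gaussTerm]; congr 1
      have : (Δ : ℂ) = A * C - B ^ 2 := by rw [h.det_eq]; ring
      rw [this, Complex.ofReal_mul]
      field_simp
      ring_nf
      simp only [I_sq]
      ring
  have s3 : Summable fun x : ℤ × ℤ => cexp (-π / Δ * (C * (x.1 - z) ^ 2
          - 2 * B * (x.1 - z) * (x.2 - w) + A * (x.2 - w) ^ 2)) := by
    refine (summable_gaussTerm (a := (π / Δ : ℝ) * C) (b := -(π / Δ * B : ℝ)) (c := (π / Δ : ℝ) * A)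
      ?_ ?_ (2 * (π / Δ) * (C * z - B * w)) (2 * (π / Δ) * (A * w - B * z))
      (-(π / Δ) * (C * z ^ 2 - 2 * B * z * w + A * w ^ 2))).congr fun x => ?_
    · rw [re_ofReal_mul]; exact mul_pos (div_pos hpi h.Δ_pos) h.C_pos
    · rw [re_ofReal_mul, re_ofReal_mul, Complex.neg_re, Complex.ofReal_re]
      have : 0 < (π / Δ) ^ 2 := by have := h.Δ_pos; positivity
      have := mul_lt_mul_of_pos_left h.det_re this
      calc _ = (π / Δ) ^ 2 * B ^ 2 := by ring
        _ < _ := this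
        _ = _ := by ring
    · rw [gaussTerm]; congr 1; push_cast; ring
  have hD : 0 < ((Δ : ℂ) / C).re := by
    rw [div_eq_mul_inv, re_ofReal_mul]; exact mul_pos h.Δ_pos hinv
  have hD0 : (Δ : ℂ) / C ≠ 0 := div_ne_zero hΔ hC
  -- Both factors have argument in (-π/2, π/2), so the principal logarithms add and no sign
  -- ambiguity arises.
  have hroot : C ^ (1 / 2 : ℂ) * ((Δ : ℂ) / C) ^ (1 / 2 : ℂ) = (√Δ : ℂ) := by
    have a1 := Complex.abs_arg_lt_pi_div_two_iff.mpr (Or.inl h.C_pos)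
    have a2 := Complex.abs_arg_lt_pi_div_two_iff.mpr (Or.inl hD)
    rw [abs_lt] at a1 a2
    have hlog : Complex.log C + Complex.log ((Δ : ℂ) / C) = Complex.log Δ := by
      rw [← Complex.log_mul hC hD0 ⟨by linarith, by linarith⟩, mul_div_cancel₀ _ hC]
    rw [cpow_def_of_ne_zero hC, cpow_def_of_ne_zero hD0, ← Complex.exp_add, ← add_mul, hlog,
      ← cpow_def_of_ne_zero hΔ, Real.sqrt_eq_rpow, Complex.ofReal_cpow h.Δ_pos.le]
    norm_num
  calc _ = ∑' k : ℤ, ∑' l : ℤ, cexp (-π * (A * (k : ℂ) ^ 2 + 2 * B * k * l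
          + C * (l : ℂ) ^ 2) + 2 * π * I * (k * z + l * w)) := s1.tsum_prod
    _ = ∑' k : ℤ, 1 / C ^ (1 / 2 : ℂ) * ∑' l : ℤ, cexp (-π * A * (k : ℂ) ^ 2 + 2 * π * I * k * z
          - π / C * ((l : ℂ) - w - I * B * k) ^ 2) := by
        refine tsum_congr fun k => ?_
        have := Complex.tsum_exp_neg_quadratic h.C_pos (I * w - B * k)
        have e : ∀ l : ℤ, cexp (-π * (A * (k : ℂ) ^ 2 + 2 * B * k * l + C * (l : ℂ) ^ 2)
            + 2 * π * I * (k * z + l * w)) = cexp (-π * A * (k : ℂ) ^ 2 + 2 * π * I * k * z) *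
            cexp (-π * C * (l : ℂ) ^ 2 + 2 * π * (I * w - B * k) * l) := fun l => by
          rw [← Complex.exp_add]; congr 1; ring
        simp_rw [e]
        rw [tsum_mul_left, this, mul_left_comm, ← tsum_mul_left]
        congr 1
        refine tsum_congr fun l => ?_
        rw [← Complex.exp_add]; congr 1
        have : (l : ℂ) + I * (I * w - B * k) = l - w - I * B * k := by
          linear_combination w * I_mul_I
        rw [this]; ring
    _ = 1 / C ^ (1 / 2 : ℂ) * ∑' l : ℤ, ∑' k : ℤ, cexp (-π * A * (k : ℂ) ^ 2 + 2 * π * I * k * z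
          - π / C * ((l : ℂ) - w - I * B * k) ^ 2) := by
        rw [tsum_mul_left]
        congr 1
        exact (Summable.tsum_comm s2).symm
    _ = 1 / C ^ (1 / 2 : ℂ) * ∑' l : ℤ, 1 / ((Δ : ℂ) / C) ^ (1 / 2 : ℂ) * ∑' k : ℤ,
          cexp (-π / Δ * (C * (k - z) ^ 2 - 2 * B * (k - z) * (l - w) + A * (l - w) ^ 2)) := by
        congr 1
        refine tsum_congr fun l => ?_
        have := Complex.tsum_exp_neg_quadratic hD (I * (z + B * (l - w) / C))
        have hd : (Δ : ℂ) = A * C - B ^ 2 := by rw [h.det_eq]; ring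
        have e : ∀ k : ℤ, cexp (-π * A * (k : ℂ) ^ 2 + 2 * π * I * k * z
            - π / C * ((l : ℂ) - w - I * B * k) ^ 2) = cexp (-π / C * (l - w) ^ 2) *
            cexp (-π * (Δ / C) * (k : ℂ) ^ 2 + 2 * π * (I * (z + B * (l - w) / C)) * k) :=
          fun k => by
          rw [← Complex.exp_add]; congr 1
          rw [hd]
          field_simp
          ring_nf
          simp only [I_sq]
          ring
        simp_rw [e]
        rw [tsum_mul_left, this, mul_left_comm, ← tsum_mul_left]
        congr 1
        refine tsum_congr fun k => ?_
        rw [← Complex.exp_add]; congr 1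
        have : (k : ℂ) + I * (I * (z + B * (l - w) / C)) = k - z - B * (l - w) / C := by
          linear_combination (z + B * (l - w) / C) * I_mul_I
        have hA : A = (Δ + B ^ 2) / C := by rw [← h.det_eq, mul_div_cancel_right₀ _ hC]
        rw [this, hA]
        field_simp
        ring
    _ = _ := by
        rw [tsum_mul_left, ← mul_assoc, div_mul_div_comm, one_mul, hroot]
        congr 1
        rw [s3.tsum_prod]
        exact Summable.tsum_comm s3

/-- The derivative of `tsum_gauss` when (z, w) moves in direction (v₁, v₂). It supplies the linear
factor of the weight-one kernel. -/
theorem tsum_linear_mul_gauss (z w v₁ v₂ : ℂ) :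
    ∑' x : ℤ × ℤ, (2 * π * I * (x.1 * v₁ + x.2 * v₂)) *
        cexp (-π * (A * (x.1 : ℂ) ^ 2 + 2 * B * x.1 * x.2 + C * (x.2 : ℂ) ^ 2)
        + 2 * π * I * (x.1 * z + x.2 * w))
      = 1 / (√Δ : ℂ) * ∑' x : ℤ × ℤ, (2 * π / Δ * (C * (x.1 - z) * v₁
          - B * ((x.1 - z) * v₂ + (x.2 - w) * v₁) + A * (x.2 - w) * v₂)) *
          cexp (-π / Δ * (C * (x.1 - z) ^ 2
          - 2 * B * (x.1 - z) * (x.2 - w) + A * (x.2 - w) ^ 2)) := by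
  have hpi : (0 : ℝ) < π := pi_pos
  have d1 := hasSum_deriv_gaussTerm (a := π * A) (b := π * B) (c := π * C)
    (by rw [re_ofReal_mul]; exact mul_pos hpi h.A_pos)
    (by simp only [re_ofReal_mul, Complex.ofReal_re]
        nlinarith [mul_lt_mul_of_pos_left h.det_re (mul_pos hpi hpi)])
    (2 * π * I * z) (2 * π * I * v₁) (2 * π * I * w) (2 * π * I * v₂) 0 0 0
  have d2 := hasSum_deriv_gaussTerm (a := (π / Δ : ℝ) * C) (b := -(π / Δ * B : ℝ))
    (c := (π / Δ : ℝ) * A)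
    (by rw [re_ofReal_mul]; exact mul_pos (div_pos hpi h.Δ_pos) h.C_pos)
    (by rw [re_ofReal_mul, re_ofReal_mul, Complex.neg_re, Complex.ofReal_re]
        have : 0 < (π / Δ) ^ 2 := by have := h.Δ_pos; positivity
        have := mul_lt_mul_of_pos_left h.det_re this
        calc _ = (π / Δ) ^ 2 * B ^ 2 := by ring
          _ < _ := this
          _ = _ := by ring)
    (2 * (π / Δ) * (C * z - B * w)) (2 * (π / Δ) * (C * v₁ - B * v₂))
    (2 * (π / Δ) * (A * w - B * z)) (2 * (π / Δ) * (A * v₂ - B * v₁))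
    (-(π / Δ) * (C * z ^ 2 - 2 * B * z * w + A * w ^ 2))
    (-(π / Δ) * (2 * C * z * v₁ - 2 * B * (z * v₂ + w * v₁) + 2 * A * w * v₂))
    (-(π / Δ) * (C * v₁ ^ 2 - 2 * B * v₁ * v₂ + A * v₂ ^ 2))
  have hF := fun ζ : ℂ => h.tsum_gauss (z + ζ * v₁) (w + ζ * v₂)
  have e1 : ∀ ζ : ℂ, ∑' x, gaussTerm (π * A) (π * B) (π * C) (2 * π * I * z + 2 * π * I * v₁ * ζ)
        (2 * π * I * w + 2 * π * I * v₂ * ζ) (0 + 0 * ζ + 0 * ζ ^ 2) x =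
      1 / (√Δ : ℂ) * ∑' x, gaussTerm ((π / Δ : ℝ) * C) (-(π / Δ * B : ℝ)) ((π / Δ : ℝ) * A)
        (2 * (π / Δ) * (C * z - B * w) + 2 * (π / Δ) * (C * v₁ - B * v₂) * ζ)
        (2 * (π / Δ) * (A * w - B * z) + 2 * (π / Δ) * (A * v₂ - B * v₁) * ζ)
        (-(π / Δ) * (C * z ^ 2 - 2 * B * z * w + A * w ^ 2) +
          -(π / Δ) * (2 * C * z * v₁ - 2 * B * (z * v₂ + w * v₁) + 2 * A * w * v₂) * ζ +
          -(π / Δ) * (C * v₁ ^ 2 - 2 * B * v₁ * v₂ + A * v₂ ^ 2) * ζ ^ 2) x := fun ζ => by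
    refine Eq.trans (Eq.trans ?_ (hF ζ)) ?_
    · refine tsum_congr fun x => ?_
      rw [gaussTerm]; congr 1; ring
    · congr 1
      refine tsum_congr fun x => ?_
      rw [gaussTerm]; congr 1; push_cast; ring
  have e2 := congrArg (fun F : ℂ → ℂ => deriv F 0) (funext e1)
  simp only [deriv_const_mul_field] at e2
  rw [← d1.tsum_eq, ← d2.tsum_eq] at e2
  refine Eq.trans (Eq.trans ?_ e2) ?_
  · refine tsum_congr fun x => ?_
    rw [gaussTerm]; congr 1
    · ring
    · congr 1; ring
  · congr 1
    refine tsum_congr fun x => ?_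
    rw [gaussTerm]; congr 1
    · ring
    · congr 1; push_cast; ring

end IsThetaForm

end

/-! ### The discriminant form of k²/(4n₁) - l²/(4n₂) -/

section

open Complex Real

/-- The quadratic character `x ↦ exp (2πi x² / (4n))` of `ZMod (2 * n)`. -/
noncomputable def quadChar (n : ℕ) (x : ZMod (2 * n)) : ℂ :=
  cexp (2 * π * I * ((x.val : ℂ) ^ 2 / (4 * n)))

/-- Replacing k by k + 2nj changes k²/(4n) by the integer kj + nj². -/
lemma quadChar_intCast (n : ℕ) [NeZero n] (k : ℤ) :
    quadChar n (k : ZMod (2 * n)) = cexp (2 * π * I * ((k : ℂ) ^ 2 / (4 * n))) := by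
  have hn : (n : ℂ) ≠ 0 := Nat.cast_ne_zero.mpr (NeZero.ne n)
  have hv : (((k : ZMod (2 * n)).val : ℤ)) = k % ((2 * n : ℕ) : ℤ) := ZMod.val_intCast k
  have hk := Int.emod_add_mul_ediv k ((2 * n : ℕ) : ℤ)
  rw [← hv] at hk
  set v := (k : ZMod (2 * n)).val
  set j := k / ((2 * n : ℕ) : ℤ)
  have hk' : (k : ℂ) = v + 2 * n * j := by exact_mod_cast hk.symm
  rw [quadChar, Complex.exp_eq_exp_iff_exists_int]
  refine ⟨-(v * j + n * j ^ 2), ?_⟩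
  rw [hk']
  push_cast
  field_simp
  ring

lemma quadChar_pow (n : ℕ) [NeZero n] (x : ZMod (2 * n)) : quadChar n x ^ (4 * n) = 1 := by
  have hn : (n : ℂ) ≠ 0 := Nat.cast_ne_zero.mpr (NeZero.ne n)
  rw [quadChar, ← Complex.exp_nat_mul, Complex.exp_eq_one_iff]
  refine ⟨(x.val : ℤ) ^ 2, ?_⟩
  push_cast
  field_simp

lemma quadChar_add (n : ℕ) [NeZero n] (x y : ZMod (2 * n)) :
    quadChar n (x + y) = quadChar n x * quadChar n y * ZMod.stdAddChar (x * y) := by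
  have hn : (n : ℂ) ≠ 0 := Nat.cast_ne_zero.mpr (NeZero.ne n)
  obtain ⟨k, rfl⟩ := ZMod.intCast_surjective x
  obtain ⟨l, rfl⟩ := ZMod.intCast_surjective y
  rw [← Int.cast_add, ← Int.cast_mul, ZMod.stdAddChar_coe, quadChar_intCast, quadChar_intCast,
    quadChar_intCast, ← Complex.exp_add, ← Complex.exp_add]
  congr 1
  push_cast
  field_simp
  ring

lemma stdAddChar_pow (n : ℕ) [NeZero n] (x : ZMod n) : ZMod.stdAddChar x ^ n = (1 : ℂ) := by
  rw [← AddChar.map_nsmul_eq_pow, nsmul_eq_mul, CharP.cast_eq_zero, zero_mul,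
    AddChar.map_zero_eq_one]

lemma sum_stdAddChar_mul (n : ℕ) [NeZero n] (x : ZMod n) :
    ∑ y, ZMod.stdAddChar (x * y) = if x = 0 then (n : ℂ) else 0 := by
  have := AddChar.sum_mulShift x (ZMod.isPrimitive_stdAddChar n)
  simp_rw [mul_comm x]
  rw [this, ZMod.card]
  split_ifs <;> simp

/-- The quadratic module of the form `k² / (4n₁) - l² / (4n₂)`. -/
noncomputable def hyperbolicModule (n₁ n₂ : ℕ) [NeZero n₁] [NeZero n₂] :
    FiniteQuadraticModule (ZMod (2 * n₁) × ZMod (2 * n₂)) where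
  b x y := ZMod.stdAddChar (-x.1 * y.1) * ZMod.stdAddChar (x.2 * y.2)
  q x := quadChar n₁ x.1 * (quadChar n₂ x.2)⁻¹
  c := 2 * (1 / (2 * √(n₁ : ℝ)) * (1 / (2 * √(n₂ : ℝ))) : ℝ)
  M := 4 * n₁ * n₂
  M_pos := by have := NeZero.pos n₁; have := NeZero.pos n₂; positivity
  b_add x y z := by
    simp only [Prod.fst_add, Prod.snd_add, neg_add, add_mul, AddChar.map_add_eq_mul]
    ring
  b_symm x y := by
    rw [mul_comm x.2, neg_mul, neg_mul, mul_comm x.1]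
  b_sum x := by
    rw [Fintype.sum_prod_type]
    simp_rw [← Finset.mul_sum]
    rw [← Finset.sum_mul, sum_stdAddChar_mul, sum_stdAddChar_mul]
    simp only [neg_eq_zero, Prod.ext_iff, Fintype.card_prod, ZMod.card, Prod.fst_zero,
      Prod.snd_zero]
    by_cases h1 : x.1 = 0 <;> by_cases h2 : x.2 = 0 <;> simp [h1, h2]
  b_pow x y := by
    have e1 : 4 * n₁ * n₂ = 2 * n₁ * (2 * n₂) := by ring
    rw [mul_pow, e1, pow_mul, stdAddChar_pow, one_pow, one_mul, mul_comm (2 * n₁), pow_mul,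
      stdAddChar_pow, one_pow]
  q_pow x := by
    have e1 : 4 * n₁ * n₂ = 4 * n₂ * n₁ := by ring
    rw [mul_pow, pow_mul, quadChar_pow, one_pow, one_mul, inv_pow, e1, pow_mul, quadChar_pow,
      one_pow, inv_one]
  q_add x y := by
    have h1 : ZMod.stdAddChar (x.1 * y.1) * ZMod.stdAddChar (-x.1 * y.1) = (1 : ℂ) := by
      rw [← AddChar.map_add_eq_mul, neg_mul, add_neg_cancel, AddChar.map_zero_eq_one]
    have h2 : (ZMod.stdAddChar (x.2 * y.2) : ℂ) ≠ 0 := fun h0 => by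
      have := stdAddChar_pow (2 * n₂) (x.2 * y.2)
      rw [h0, zero_pow (NeZero.ne _)] at this
      exact zero_ne_one this
    rw [Prod.fst_add, Prod.snd_add, quadChar_add, quadChar_add, mul_inv, mul_inv]
    calc _ = quadChar n₁ x.1 * quadChar n₁ y.1 * ((quadChar n₂ x.2)⁻¹ * (quadChar n₂ y.2)⁻¹)
        * (ZMod.stdAddChar (x.1 * y.1) * ZMod.stdAddChar (-x.1 * y.1))
        * ((ZMod.stdAddChar (x.2 * y.2))⁻¹ * ZMod.stdAddChar (x.2 * y.2)) := by ring
      _ = _ := by rw [h1, inv_mul_cancel₀ h2]; ring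
  c_sq := by
    have h1 : (0 : ℝ) < n₁ := by exact_mod_cast NeZero.pos n₁
    have h2 : (0 : ℝ) < n₂ := by exact_mod_cast NeZero.pos n₂
    have : (2 * (1 / (2 * √(n₁ : ℝ)) * (1 / (2 * √(n₂ : ℝ))))) ^ 2 * ((2 * n₁) * (2 * n₂)) = 1 := by
      have e1 := Real.sq_sqrt h1.le
      have e2 := Real.sq_sqrt h2.le
      field_simp
      rw [e1, e2]
    rw [Fintype.card_prod, ZMod.card, ZMod.card]
    exact_mod_cast this

end

/-! ### The Siegel theta kernel and its behaviour under T -/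

section

open Complex Real
open UpperHalfPlane hiding I
open scoped ComplexConjugate

/-- The scale `1 / (2√n)`, whose square is `1 / (4n)`. -/
noncomputable def scale (n : ℕ) : ℝ := 1 / (2 * √(n : ℝ))

lemma scale_pos (n : ℕ) [NeZero n] : 0 < scale n := by
  have : (0 : ℝ) < n := by exact_mod_cast NeZero.pos n
  unfold scale; positivity

lemma scale_sq (n : ℕ) : scale n ^ 2 = 1 / (4 * n) := by
  rw [scale, div_pow, mul_pow, Real.sq_sqrt (Nat.cast_nonneg n)]; norm_num

/-- The positive coordinate of the plane vector `(k, l)` in the frame rotated by `u`. -/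
noncomputable def posCoord (n₁ n₂ : ℕ) (u : ℝ) (x : ℤ × ℤ) : ℝ :=
  scale n₁ * x.1 * Real.cosh u + scale n₂ * x.2 * Real.sinh u

/-- The negative coordinate of the plane vector `(k, l)` in the frame rotated by `u`. -/
noncomputable def negCoord (n₁ n₂ : ℕ) (u : ℝ) (x : ℤ × ℤ) : ℝ :=
  scale n₁ * x.1 * Real.sinh u + scale n₂ * x.2 * Real.cosh u

lemma posCoord_sq_sub (n₁ n₂ : ℕ) (u : ℝ) (x : ℤ × ℤ) :
    posCoord n₁ n₂ u x ^ 2 - negCoord n₁ n₂ u x ^ 2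
      = (x.1 : ℝ) ^ 2 / (4 * n₁) - (x.2 : ℝ) ^ 2 / (4 * n₂) := by
  have h := Real.cosh_sq' u
  have h1 := scale_sq n₁
  have h2 := scale_sq n₂
  rw [posCoord, negCoord]
  linear_combination (scale n₁ ^ 2 * (x.1 : ℝ) ^ 2 - scale n₂ ^ 2 * (x.2 : ℝ) ^ 2) * h
    + (x.1 : ℝ) ^ 2 * h1 - (x.2 : ℝ) ^ 2 * h2

/-- In light-cone coordinates a ± b the hyperbolic rotation is scaling by exp(±u), which shrinks
squares by at most exp(-2U). -/
lemma le_posCoord_sq_add (n₁ n₂ : ℕ) {u U : ℝ} (hu : |u| ≤ U) (x : ℤ × ℤ) :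
    Real.exp (-(2 * U)) * (scale n₁ ^ 2 * (x.1 : ℝ) ^ 2 + scale n₂ ^ 2 * (x.2 : ℝ) ^ 2)
      ≤ posCoord n₁ n₂ u x ^ 2 + negCoord n₁ n₂ u x ^ 2 := by
  have hu' := abs_le.mp hu
  have h1 : Real.exp (-(2 * U)) ≤ Real.exp u ^ 2 := by
    rw [← Real.exp_nat_mul]; exact Real.exp_le_exp.mpr (by push_cast; linarith)
  have h2 : Real.exp (-(2 * U)) ≤ Real.exp (-u) ^ 2 := by
    rw [← Real.exp_nat_mul]; exact Real.exp_le_exp.mpr (by push_cast; linarith)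
  set a := scale n₁ * (x.1 : ℝ) with ha
  set b := scale n₂ * (x.2 : ℝ) with hb
  have e : posCoord n₁ n₂ u x ^ 2 + negCoord n₁ n₂ u x ^ 2
      = (Real.exp u ^ 2 * (a + b) ^ 2 + Real.exp (-u) ^ 2 * (a - b) ^ 2) / 2 := by
    rw [posCoord, negCoord, Real.cosh_eq, Real.sinh_eq]; ring
  rw [e, ← mul_pow, ← mul_pow, ← ha, ← hb]
  have h3 := mul_le_mul_of_nonneg_right h1 (sq_nonneg (a + b))
  have h4 := mul_le_mul_of_nonneg_right h2 (sq_nonneg (a - b))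
  nlinarith

/-- This is why the kernel carries the factor `posCoord`: it makes the u-integrand an exact
derivative in `integral_siegelTerm`. -/
lemma hasDerivAt_negCoord (n₁ n₂ : ℕ) (x : ℤ × ℤ) (u : ℝ) :
    HasDerivAt (fun u => negCoord n₁ n₂ u x) (posCoord n₁ n₂ u x) u :=
  ((Real.hasDerivAt_sinh u).const_mul _).add ((Real.hasDerivAt_cosh u).const_mul _)

/-- The summand of the Siegel theta kernel. -/
noncomputable def siegelTerm (n₁ n₂ : ℕ) (τ : ℍ) (u : ℝ) (x : ℤ × ℤ) : ℂ :=
  (√τ.im * posCoord n₁ n₂ u x : ℝ) *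
    cexp (2 * π * I * (τ * (posCoord n₁ n₂ u x : ℂ) ^ 2 - conj (τ : ℂ) * (negCoord n₁ n₂ u x : ℂ) ^ 2))

lemma continuous_siegelTerm (n₁ n₂ : ℕ) (τ : ℍ) (x : ℤ × ℤ) :
    Continuous fun u => siegelTerm n₁ n₂ τ u x := by
  unfold siegelTerm posCoord negCoord
  have := Real.continuous_cosh
  have := Real.continuous_sinh
  fun_prop

/-- The majorant is uniform in all τ with imaginary part at least y, without an upper bound;
boundedness at i∞ depends on this. -/
lemma exists_norm_siegelTerm_le (n₁ n₂ : ℕ) [NeZero n₁] [NeZero n₂] (U : ℝ) {y : ℝ} (hy : 0 < y) :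
    ∃ g : ℤ × ℤ → ℝ, Summable g ∧ ∀ τ : ℍ, y ≤ τ.im → ∀ u, |u| ≤ U → ∀ x,
      ‖siegelTerm n₁ n₂ τ u x‖ ≤ g x := by
  set m := min (scale n₁ ^ 2) (scale n₂ ^ 2) with hm
  have hm0 : 0 < m := lt_min (pow_pos (scale_pos n₁) 2) (pow_pos (scale_pos n₂) 2)
  have hc : 0 < y * (Real.exp (-(2 * U)) * m) := by positivity
  refine ⟨_, summable_exp_neg_sq_add_abs hc 0, fun τ hτ u hu x => ?_⟩
  have hτ0 := τ.im_pos
  set a := posCoord n₁ n₂ u x with ha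
  set b := negCoord n₁ n₂ u x with hb
  have hre : (2 * π * I * (τ * (a : ℂ) ^ 2 - conj (τ : ℂ) * (b : ℂ) ^ 2)).re
      = -(2 * π * τ.im * (a ^ 2 + b ^ 2)) := by
    simp [pow_two]
    ring
  rw [siegelTerm, norm_mul, Complex.norm_exp, hre, Complex.norm_real, Real.norm_eq_abs, abs_mul,
    abs_of_nonneg (Real.sqrt_nonneg _)]
  -- The linear factor is absorbed into part of the Gaussian decay exp(-2πy(a²+b²)).
  have h1 : √τ.im * |a| ≤ Real.exp (τ.im * a ^ 2) := by
    have h2 := Real.add_one_le_exp (τ.im * a ^ 2)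
    have h3 : (√τ.im * |a|) ^ 2 = τ.im * a ^ 2 := by
      rw [mul_pow, Real.sq_sqrt hτ0.le, sq_abs]
    nlinarith [sq_nonneg (√τ.im * |a| - 1)]
  refine (mul_le_mul_of_nonneg_right h1 (Real.exp_pos _).le).trans ?_
  rw [← Real.exp_add]
  refine Real.exp_le_exp.mpr ?_
  have h4 := le_posCoord_sq_add n₁ n₂ hu x
  rw [← ha, ← hb] at h4
  have h5 : m * ((x.1 : ℝ) ^ 2 + (x.2 : ℝ) ^ 2)
      ≤ scale n₁ ^ 2 * (x.1 : ℝ) ^ 2 + scale n₂ ^ 2 * (x.2 : ℝ) ^ 2 := by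
    rw [mul_add]
    gcongr
    · exact min_le_left _ _
    · exact min_le_right _ _
  have h6 : Real.exp (-(2 * U)) * m * ((x.1 : ℝ) ^ 2 + (x.2 : ℝ) ^ 2) ≤ a ^ 2 + b ^ 2 := by
    rw [mul_assoc]
    exact (mul_le_mul_of_nonneg_left h5 (Real.exp_pos _).le).trans h4
  have h7 : y * (Real.exp (-(2 * U)) * m * ((x.1 : ℝ) ^ 2 + (x.2 : ℝ) ^ 2))
      ≤ τ.im * (a ^ 2 + b ^ 2) := mul_le_mul hτ h6 (by positivity) hτ0.le
  have h8 : τ.im * (a ^ 2 + b ^ 2) ≤ π * (τ.im * (a ^ 2 + b ^ 2)) :=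
    le_mul_of_one_le_left (by positivity) (by linarith [Real.pi_gt_three])
  have h9 : τ.im * a ^ 2 ≤ τ.im * (a ^ 2 + b ^ 2) := by
    gcongr; linarith [sq_nonneg b]
  nlinarith

/-- Reduction of an integer vector. -/
def reduce (n₁ n₂ : ℕ) (x : ℤ × ℤ) : ZMod (2 * n₁) × ZMod (2 * n₂) := (x.1, x.2)

/-- The Siegel theta kernel of weight one attached to a function on the discriminant group. -/
noncomputable def siegelTheta (n₁ n₂ : ℕ) (φ : ZMod (2 * n₁) × ZMod (2 * n₂) → ℂ) (τ : ℍ) (u : ℝ) :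
    ℂ := ∑' x, φ (reduce n₁ n₂ x) * siegelTerm n₁ n₂ τ u x

section
variable (n₁ n₂ : ℕ) [NeZero n₁] [NeZero n₂] (φ : ZMod (2 * n₁) × ZMod (2 * n₂) → ℂ)

lemma exists_norm_mul_siegelTerm_le (U : ℝ) {y : ℝ} (hy : 0 < y) :
    ∃ g : ℤ × ℤ → ℝ, Summable g ∧ ∀ τ : ℍ, y ≤ τ.im → ∀ u, |u| ≤ U → ∀ x,
      ‖φ (reduce n₁ n₂ x) * siegelTerm n₁ n₂ τ u x‖ ≤ g x := by
  obtain ⟨g, hg, h⟩ := exists_norm_siegelTerm_le n₁ n₂ U hy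
  refine ⟨_, hg.mul_left (∑ z, ‖φ z‖), fun τ hτ u hu x => ?_⟩
  rw [norm_mul]
  exact mul_le_mul (Finset.single_le_sum (f := fun z => ‖φ z‖) (fun _ _ => norm_nonneg _)
    (Finset.mem_univ _)) (h τ hτ u hu x) (norm_nonneg _)
    (Finset.sum_nonneg fun _ _ => norm_nonneg _)

lemma summable_mul_siegelTerm (τ : ℍ) (u : ℝ) :
    Summable fun x => φ (reduce n₁ n₂ x) * siegelTerm n₁ n₂ τ u x := by
  obtain ⟨g, hg, h⟩ := exists_norm_mul_siegelTerm_le n₁ n₂ φ |u| τ.im_pos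
  exact hg.of_norm_bounded (h τ le_rfl u le_rfl)

lemma siegelTheta_vadd_one (τ : ℍ) (u : ℝ) :
    siegelTheta n₁ n₂ φ ((1 : ℝ) +ᵥ τ) u
      = siegelTheta n₁ n₂ ((hyperbolicModule n₁ n₂).quad φ) τ u := by
  refine tsum_congr fun x => ?_
  have hq : (hyperbolicModule n₁ n₂).q (reduce n₁ n₂ x)
      = cexp (2 * π * I * ((x.1 : ℂ) ^ 2 / (4 * n₁) - (x.2 : ℂ) ^ 2 / (4 * n₂))) := by
    change quadChar n₁ _ * (quadChar n₂ _)⁻¹ = _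
    rw [reduce, quadChar_intCast, quadChar_intCast, ← Complex.exp_neg, ← Complex.exp_add]
    congr 1; ring
  have hs : siegelTerm n₁ n₂ ((1 : ℝ) +ᵥ τ) u x = cexp (2 * π * I * ((x.1 : ℂ) ^ 2 / (4 * n₁) -
      (x.2 : ℂ) ^ 2 / (4 * n₂))) * siegelTerm n₁ n₂ τ u x := by
    have hQ := congrArg (fun r : ℝ => (r : ℂ)) (posCoord_sq_sub n₁ n₂ u x)
    push_cast at hQ
    rw [siegelTerm, siegelTerm, UpperHalfPlane.vadd_im, UpperHalfPlane.coe_vadd, mul_left_comm,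
      ← Complex.exp_add, ← hQ]
    congr 2
    simp only [Complex.ofReal_one, map_add, map_one]
    ring
  rw [hs, FiniteQuadraticModule.quad_apply, hq]
  ring

end

end

/-! ### Poisson summation for the kernel on a lattice coset -/

section

open Complex Real
open UpperHalfPlane hiding I
open scoped ComplexConjugate

section
variable (n₁ n₂ : ℕ) [NeZero n₁] [NeZero n₂]

/-- The exponent of the kernel at τ is -π times this form in (k, l). Its determinant does not depend
on u, because cosh² - sinh² = 1. -/
lemma isThetaForm_siegel (τ : ℍ) (u : ℝ) :
    IsThetaForm (2 * scale n₁ ^ 2 * (τ.im * (Real.cosh u ^ 2 + Real.sinh u ^ 2) - I * τ.re))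
      (2 * scale n₂ ^ 2 * (τ.im * (Real.cosh u ^ 2 + Real.sinh u ^ 2) + I * τ.re))
      (4 * τ.im * scale n₁ * scale n₂ * (Real.sinh u * Real.cosh u))
      (4 * scale n₁ ^ 2 * scale n₂ ^ 2 * (τ.re ^ 2 + τ.im ^ 2)) := by
  have h1 := scale_pos n₁
  have h2 := scale_pos n₂
  have hy := τ.im_pos
  have hc := Real.cosh_pos u
  have hcs := Real.cosh_sq' u
  set α := scale n₁
  set β := scale n₂
  set y := τ.im
  set x := τ.re
  set c := Real.cosh u
  set s := Real.sinh u
  have eA : (2 * (α : ℂ) ^ 2 * (y * ((c : ℂ) ^ 2 + (s : ℂ) ^ 2) - I * x)).re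
      = 2 * α ^ 2 * (y * (c ^ 2 + s ^ 2)) := by
    rw [show (2 * (α : ℂ) ^ 2 * (y * ((c : ℂ) ^ 2 + (s : ℂ) ^ 2) - I * x))
      = ((2 * α ^ 2 : ℝ) : ℂ) * ((y * (c ^ 2 + s ^ 2) : ℝ) - I * x) by push_cast; ring,
      re_ofReal_mul, Complex.sub_re, Complex.ofReal_re, Complex.I_mul_re, Complex.ofReal_im]
    ring
  have eC : (2 * (β : ℂ) ^ 2 * (y * ((c : ℂ) ^ 2 + (s : ℂ) ^ 2) + I * x)).re
      = 2 * β ^ 2 * (y * (c ^ 2 + s ^ 2)) := by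
    rw [show (2 * (β : ℂ) ^ 2 * (y * ((c : ℂ) ^ 2 + (s : ℂ) ^ 2) + I * x))
      = ((2 * β ^ 2 : ℝ) : ℂ) * ((y * (c ^ 2 + s ^ 2) : ℝ) + I * x) by push_cast; ring,
      re_ofReal_mul, Complex.add_re, Complex.ofReal_re, Complex.I_mul_re, Complex.ofReal_im]
    ring
  refine ⟨?_, ?_, by positivity, ?_, ?_⟩
  · rw [eA]; positivity
  · rw [eC]; positivity
  · rw [eA, eC]
    have h3 : 2 * α ^ 2 * (y * (c ^ 2 + s ^ 2)) * (2 * β ^ 2 * (y * (c ^ 2 + s ^ 2)))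
        = (4 * y * α * β * (s * c)) ^ 2 + 4 * (y * α * β) ^ 2 := by
      linear_combination (4 * (y * α * β) ^ 2 * (c ^ 2 - s ^ 2 + 1)) * hcs
    rw [h3]
    exact lt_add_of_pos_right _ (by positivity)
  · have hcs' : (c : ℂ) ^ 2 = 1 + (s : ℂ) ^ 2 := by exact_mod_cast hcs
    push_cast
    linear_combination (4 * (α : ℂ) ^ 2 * (β : ℂ) ^ 2 * y ^ 2 * (c ^ 2 - s ^ 2 + 1)) * hcs'
      - (4 * (α : ℂ) ^ 2 * (β : ℂ) ^ 2 * x ^ 2) * I_sq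

/-- `tsum_linear_mul_gauss` in the direction that makes the linear form `posCoord`. Dualising
changes the sign of the mixed coefficient; writing the second coordinate as r - 2n₂x₂ restores it.
-/
lemma tsum_siegelTerm_dual (p r : ℤ) {τ σ : ℍ} (hσ : (σ : ℂ) = -1 / τ) (u : ℝ) :
    ∑' x : ℤ × ℤ, siegelTerm n₁ n₂ σ u (2 * n₁ * x.1 + p, r - 2 * n₂ * x.2)
      = 2 * (scale n₁ * scale n₂ : ℝ) * τ * ∑' x : ℤ × ℤ,
        cexp (2 * π * I * (-(p * x.1) / (2 * n₁) + r * x.2 / (2 * n₂))) *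
          siegelTerm n₁ n₂ τ u x := by
  have hα := scale_pos n₁
  have hβ := scale_pos n₂
  have hα2 : (scale n₁ : ℂ) ^ 2 = 1 / (4 * n₁) := by
    rw [← Complex.ofReal_pow, scale_sq]; push_cast; rfl
  have hβ2 : (scale n₂ : ℂ) ^ 2 = 1 / (4 * n₂) := by
    rw [← Complex.ofReal_pow, scale_sq]; push_cast; rfl
  have hn1 : (n₁ : ℂ) ≠ 0 := Nat.cast_ne_zero.mpr (NeZero.ne n₁)
  have hn2 : (n₂ : ℂ) ≠ 0 := Nat.cast_ne_zero.mpr (NeZero.ne n₂)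
  have hy := τ.im_pos
  have hτ : (τ : ℂ) = τ.re + τ.im * I := (Complex.re_add_im _).symm
  have hcs : (Real.cosh u : ℂ) ^ 2 = 1 + (Real.sinh u : ℂ) ^ 2 := by exact_mod_cast Real.cosh_sq' u
  have hT : 0 < τ.re ^ 2 + τ.im ^ 2 := by positivity
  have hTc : ((τ.re : ℂ) ^ 2 + (τ.im : ℂ) ^ 2) ≠ 0 := by exact_mod_cast hT.ne'
  have hτ0 : (τ : ℂ) ≠ 0 := UpperHalfPlane.ne_zero τ
  have hσ' : (σ : ℂ) = (-τ.re + τ.im * I) / ((τ.re : ℂ) ^ 2 + (τ.im : ℂ) ^ 2) := by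
    rw [hσ, div_eq_div_iff hτ0 hTc, hτ]
    linear_combination (-(τ.im : ℂ) ^ 2) * I_sq
  have hσc : conj (σ : ℂ) = (-τ.re - τ.im * I) / ((τ.re : ℂ) ^ 2 + (τ.im : ℂ) ^ 2) := by
    rw [hσ']
    simp only [map_div₀, map_add, map_mul, map_neg, map_pow, Complex.conj_ofReal, Complex.conj_I]
    ring
  have hτc : conj (τ : ℂ) = τ.re - τ.im * I := by
    rw [hτ]; simp [sub_eq_add_neg]
  have hσim : σ.im = τ.im / (τ.re ^ 2 + τ.im ^ 2) := by
    have := congrArg Complex.im hσ'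
    rw [show (-(τ.re : ℂ) + τ.im * I) / ((τ.re : ℂ) ^ 2 + (τ.im : ℂ) ^ 2)
      = (((τ.re ^ 2 + τ.im ^ 2)⁻¹ : ℝ) : ℂ) * (-(τ.re : ℂ) + τ.im * I) by
        push_cast; rw [div_eq_inv_mul], Complex.im_ofReal_mul] at this
    simp only [Complex.add_im, Complex.neg_im, Complex.ofReal_im, Complex.mul_im, Complex.I_re,
      Complex.I_im, Complex.ofReal_re, mul_zero, mul_one, neg_zero, zero_add, add_zero] at this
    rw [div_eq_inv_mul]; exact this
  have key := (isThetaForm_siegel n₁ n₂ τ u).tsum_linear_mul_gauss (-p / (2 * n₁)) (r / (2 * n₂))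
    (scale n₁ * Real.cosh u) (scale n₂ * Real.sinh u)
  have hsΔ : √(4 * scale n₁ ^ 2 * scale n₂ ^ 2 * (τ.re ^ 2 + τ.im ^ 2))
      = 2 * scale n₁ * scale n₂ * √(τ.re ^ 2 + τ.im ^ 2) := by
    rw [show 4 * scale n₁ ^ 2 * scale n₂ ^ 2 * (τ.re ^ 2 + τ.im ^ 2)
      = (2 * scale n₁ * scale n₂) ^ 2 * (τ.re ^ 2 + τ.im ^ 2) by ring,
      Real.sqrt_mul (sq_nonneg _), Real.sqrt_sq (by positivity)]
  have hsσ : √σ.im = √τ.im / √(τ.re ^ 2 + τ.im ^ 2) := by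
    rw [hσim, Real.sqrt_div hy.le]
  have hpi : (π : ℂ) ≠ 0 := by exact_mod_cast pi_ne_zero
  have hαc : (scale n₁ : ℂ) ≠ 0 := by exact_mod_cast hα.ne'
  have hβc : (scale n₂ : ℂ) ≠ 0 := by exact_mod_cast hβ.ne'
  have hsT : (√(τ.re ^ 2 + τ.im ^ 2) : ℂ) ≠ 0 := by exact_mod_cast (Real.sqrt_pos.mpr hT).ne'
  have hsy : (√τ.im : ℂ) ≠ 0 := by exact_mod_cast (Real.sqrt_pos.mpr hy).ne'
  set α := scale n₁ with hαdef
  set β := scale n₂ with hβdef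
  -- the two sides of `key`
  have eL : ∀ x : ℤ × ℤ, cexp (2 * π * I * (-(p * x.1) / (2 * n₁) + r * x.2 / (2 * n₂))) *
      siegelTerm n₁ n₂ τ u x = (√τ.im / (2 * π * I) : ℂ) *
      ((2 * π * I * (x.1 * (α * Real.cosh u) + x.2 * (β * Real.sinh u))) *
        cexp (-π * ((2 * α ^ 2 * (τ.im * (Real.cosh u ^ 2 + Real.sinh u ^ 2) - I * τ.re))
        * (x.1 : ℂ) ^ 2 + 2 * (4 * τ.im * α * β * (Real.sinh u * Real.cosh u) : ℝ) * x.1 * x.2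
        + (2 * β ^ 2 * (τ.im * (Real.cosh u ^ 2 + Real.sinh u ^ 2) + I * τ.re)) * (x.2 : ℂ) ^ 2)
        + 2 * π * I * (x.1 * (-p / (2 * n₁)) + x.2 * (r / (2 * n₂))))) := by
    intro x
    have hexp : 2 * π * I * (-(p * x.1) / (2 * n₁) + r * x.2 / (2 * n₂)) +
        2 * π * I * (τ * (posCoord n₁ n₂ u x : ℂ) ^ 2 - conj (τ : ℂ) * (negCoord n₁ n₂ u x : ℂ) ^ 2)
        = -π * ((2 * α ^ 2 * (τ.im * (Real.cosh u ^ 2 + Real.sinh u ^ 2) - I * τ.re))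
        * (x.1 : ℂ) ^ 2 + 2 * (4 * τ.im * α * β * (Real.sinh u * Real.cosh u) : ℝ) * x.1 * x.2
        + (2 * β ^ 2 * (τ.im * (Real.cosh u ^ 2 + Real.sinh u ^ 2) + I * τ.re)) * (x.2 : ℂ) ^ 2)
        + 2 * π * I * (x.1 * (-p / (2 * n₁)) + x.2 * (r / (2 * n₂))) := by
      rw [hτc, hτ, posCoord, negCoord, ← hαdef, ← hβdef]
      push_cast [-Complex.ofReal_cosh, -Complex.ofReal_sinh]
      linear_combination (2 * π * I * τ.re * ((α : ℂ) ^ 2 * (x.1 : ℂ) ^ 2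
        - (β : ℂ) ^ 2 * (x.2 : ℂ) ^ 2)) * hcs + (2 * π * τ.im * ((α * x.1 * Real.cosh u
        + β * x.2 * Real.sinh u) ^ 2 + (α * x.1 * Real.sinh u + β * x.2 * Real.cosh u) ^ 2)) * I_sq
    rw [siegelTerm, mul_left_comm, ← Complex.exp_add, hexp, posCoord, ← hαdef, ← hβdef]
    generalize cexp _ = E
    push_cast [-Complex.ofReal_cosh, -Complex.ofReal_sinh]
    field_simp
  have eR : ∀ x : ℤ × ℤ, siegelTerm n₁ n₂ σ u (2 * n₁ * x.1 + p, r - 2 * n₂ * x.2)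
      = (τ * √σ.im / (2 * π * I) : ℂ) *
      ((2 * π / (4 * α ^ 2 * β ^ 2 * (τ.re ^ 2 + τ.im ^ 2) : ℝ) *
        ((2 * β ^ 2 * (τ.im * (Real.cosh u ^ 2 + Real.sinh u ^ 2) + I * τ.re)) *
          (x.1 - -p / (2 * n₁)) * (α * Real.cosh u)
        - (4 * τ.im * α * β * (Real.sinh u * Real.cosh u) : ℝ) *
          ((x.1 - -p / (2 * n₁)) * (β * Real.sinh u) + (x.2 - r / (2 * n₂)) * (α * Real.cosh u))
        + (2 * α ^ 2 * (τ.im * (Real.cosh u ^ 2 + Real.sinh u ^ 2) - I * τ.re)) *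
          (x.2 - r / (2 * n₂)) * (β * Real.sinh u))) *
        cexp (-π / (4 * α ^ 2 * β ^ 2 * (τ.re ^ 2 + τ.im ^ 2) : ℝ) *
        ((2 * β ^ 2 * (τ.im * (Real.cosh u ^ 2 + Real.sinh u ^ 2) + I * τ.re)) *
          (x.1 - -p / (2 * n₁)) ^ 2
        - 2 * (4 * τ.im * α * β * (Real.sinh u * Real.cosh u) : ℝ) * (x.1 - -p / (2 * n₁)) *
          (x.2 - r / (2 * n₂))
        + (2 * α ^ 2 * (τ.im * (Real.cosh u ^ 2 + Real.sinh u ^ 2) - I * τ.re)) *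
          (x.2 - r / (2 * n₂)) ^ 2))) := by
    intro x
    have hX : (x.1 - -p / (2 * n₁) : ℂ) = 2 * α ^ 2 * (2 * n₁ * x.1 + p) := by
      rw [hα2]; field_simp; ring
    have hY : (x.2 - r / (2 * n₂) : ℂ) = -2 * β ^ 2 * (r - 2 * n₂ * x.2) := by
      rw [hβ2]; field_simp; ring
    rw [hX, hY, siegelTerm, posCoord, negCoord, ← hαdef, ← hβdef, hσc, hσ']
    push_cast [-Complex.ofReal_cosh, -Complex.ofReal_sinh]
    generalize (2 * n₁ * x.1 + p : ℂ) = K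
    generalize (r - 2 * n₂ * x.2 : ℂ) = L
    generalize (Real.cosh u : ℂ) = c at hcs
    generalize (Real.sinh u : ℂ) = s at hcs
    have hlin : (2 * β ^ 2 * (τ.im * (c ^ 2 + s ^ 2) + I * τ.re)) * (2 * α ^ 2 * K) * (α * c)
        - 4 * τ.im * α * β * (s * c) * (2 * α ^ 2 * K * (β * s) + -2 * β ^ 2 * L * (α * c))
        + (2 * α ^ 2 * (τ.im * (c ^ 2 + s ^ 2) - I * τ.re)) * (-2 * β ^ 2 * L) * (β * s)
        = 4 * (α : ℂ) ^ 2 * β ^ 2 * ((τ.im + I * τ.re) * (α * K * c + β * L * s)) := by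
      linear_combination (4 * (α : ℂ) ^ 2 * β ^ 2 * τ.im * (α * K * c + β * L * s)) * hcs
    have hquad : (2 * β ^ 2 * (τ.im * (c ^ 2 + s ^ 2) + I * τ.re)) * (2 * α ^ 2 * K) ^ 2
        - 2 * (4 * τ.im * α * β * (s * c)) * (2 * α ^ 2 * K) * (-2 * β ^ 2 * L)
        + (2 * α ^ 2 * (τ.im * (c ^ 2 + s ^ 2) - I * τ.re)) * (-2 * β ^ 2 * L) ^ 2
        = 4 * (α : ℂ) ^ 2 * β ^ 2 * (-(2 * I * ((-τ.re + τ.im * I) * (α * K * c + β * L * s) ^ 2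
          - (-τ.re - τ.im * I) * (α * K * s + β * L * c) ^ 2))) := by
      linear_combination (-(8 * (α : ℂ) ^ 2 * β ^ 2 * I * τ.re *
        ((α : ℂ) ^ 2 * K ^ 2 - β ^ 2 * L ^ 2))) * hcs +
        (8 * (α : ℂ) ^ 2 * β ^ 2 * τ.im *
          ((α * K * c + β * L * s) ^ 2 + (α * K * s + β * L * c) ^ 2)) * I_sq
    -- The dual linear form carries the factor i times the conjugate of τ; times τ this is i|τ|²,
    -- which cancels the |τ|² in Δ and accounts for the automorphy factor τ.
    have hττ : ((τ.re : ℂ) + τ.im * I) * (τ.im + I * τ.re)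
        = I * ((τ.re : ℂ) ^ 2 + (τ.im : ℂ) ^ 2) := by
      linear_combination ((τ.re : ℂ) * τ.im) * I_sq
    rw [hlin, hquad, ← mul_assoc (τ * √σ.im / (2 * π * I) : ℂ)]
    congr 1
    · rw [hτ]
      field_simp
      linear_combination (-(√σ.im : ℂ) * (α * K * c + β * L * s)) * hττ
    · congr 1
      field_simp
  simp_rw [eL, eR]
  rw [tsum_mul_left, tsum_mul_left, key, hsΔ, hsσ]
  generalize (∑' x : ℤ × ℤ, (_ : ℂ)) = Z
  push_cast [-Complex.ofReal_cosh, -Complex.ofReal_sinh]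
  field_simp
end

end

/-! ### Transformation and boundedness of the theta integral -/

section

open Complex Real
open UpperHalfPlane hiding I
open scoped ComplexConjugate

section
variable (n₁ n₂ : ℕ) [NeZero n₁] [NeZero n₂] (φ : ZMod (2 * n₁) × ZMod (2 * n₂) → ℂ)

lemma tsum_coset_eq (p r : ℤ) (f : ℤ × ℤ → ℂ) :
    ∑' x : ℤ × ℤ, (if reduce n₁ n₂ x = (↑p, ↑r) then f x else 0)
      = ∑' x : ℤ × ℤ, f (2 * n₁ * x.1 + p, r - 2 * n₂ * x.2) := by
  have h1 : (n₁ : ℤ) ≠ 0 := by exact_mod_cast NeZero.ne n₁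
  have h2 : (n₂ : ℤ) ≠ 0 := by exact_mod_cast NeZero.ne n₂
  have hinj : Function.Injective
      (fun x : ℤ × ℤ => ((2 * n₁ * x.1 + p, r - 2 * n₂ * x.2) : ℤ × ℤ)) := by
    rintro ⟨a, b⟩ ⟨c, d⟩ h
    simp only [Prod.mk.injEq, add_left_inj, sub_right_inj] at h
    rw [Prod.mk.injEq]
    exact ⟨mul_left_cancel₀ (mul_ne_zero two_ne_zero h1) h.1,
      mul_left_cancel₀ (mul_ne_zero two_ne_zero h2) h.2⟩
  rw [← hinj.tsum_eq]
  · refine tsum_congr fun x => if_pos ?_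
    have e1 : ((2 * n₁ : ℕ) : ZMod (2 * n₁)) = 0 := ZMod.natCast_self _
    have e2 : ((2 * n₂ : ℕ) : ZMod (2 * n₂)) = 0 := ZMod.natCast_self _
    push_cast at e1 e2
    simp [reduce, e1, e2]
  · intro x hx
    rw [Function.mem_support, ne_eq, ite_eq_right_iff, Classical.not_imp] at hx
    have hx' := hx.1
    rw [reduce, Prod.mk.injEq, ZMod.intCast_eq_intCast_iff_dvd_sub,
      ZMod.intCast_eq_intCast_iff_dvd_sub] at hx'
    obtain ⟨⟨a, ha⟩, b, hb⟩ := hx'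
    refine ⟨(-a, b), Prod.ext ?_ ?_⟩
    · push_cast at ha; simp only; linarith
    · push_cast at hb; simp only; linarith

/-- By linearity it suffices to treat the indicator of one coset, which is `tsum_siegelTerm_dual`;
the characters appearing there are the values of the bicharacter. -/
lemma siegelTheta_inv {τ σ : ℍ} (hσ : (σ : ℂ) = -1 / τ) (u : ℝ) :
    siegelTheta n₁ n₂ φ σ u = τ * siegelTheta n₁ n₂ ((hyperbolicModule n₁ n₂).fourier φ) τ u := by
  set D := hyperbolicModule n₁ n₂ with hD
  have hb : ∀ z x, D.b (reduce n₁ n₂ x) z = D.b z (reduce n₁ n₂ x) := fun z x => D.b_symm _ _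
  have hcoset : ∀ z, ∑' x : ℤ × ℤ, (if reduce n₁ n₂ x = z then siegelTerm n₁ n₂ σ u x else 0)
      = D.c * τ * ∑' x : ℤ × ℤ, D.b z (reduce n₁ n₂ x) * siegelTerm n₁ n₂ τ u x := by
    rintro ⟨z₁, z₂⟩
    obtain ⟨p, rfl⟩ := ZMod.intCast_surjective z₁
    obtain ⟨r, rfl⟩ := ZMod.intCast_surjective z₂
    rw [tsum_coset_eq, tsum_siegelTerm_dual n₁ n₂ p r hσ]
    congr 1
    refine tsum_congr fun x => ?_
    congr 1
    change _ = (ZMod.stdAddChar (-(p : ZMod (2 * n₁)) * ((x.1 : ℤ) : ZMod (2 * n₁))) : ℂ) *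
      ZMod.stdAddChar ((r : ZMod (2 * n₂)) * ((x.2 : ℤ) : ZMod (2 * n₂)))
    have e1 : -(p : ZMod (2 * n₁)) * ((x.1 : ℤ) : ZMod (2 * n₁)) = ((-p * x.1 : ℤ) : ZMod _) := by
      push_cast; rfl
    have e2 : (r : ZMod (2 * n₂)) * ((x.2 : ℤ) : ZMod (2 * n₂)) = ((r * x.2 : ℤ) : ZMod _) := by
      push_cast; rfl
    rw [e1, e2, ZMod.stdAddChar_coe, ZMod.stdAddChar_coe, ← Complex.exp_add]
    congr 1
    push_cast
    ring
  have s1 : ∀ z, Summable fun x : ℤ × ℤ =>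
      φ z * (if reduce n₁ n₂ x = z then siegelTerm n₁ n₂ σ u x else 0) := fun z => by
    refine ((summable_mul_siegelTerm n₁ n₂ (fun w => if w = z then 1 else 0) σ u).mul_left
      (φ z)).congr fun x => ?_
    by_cases h : reduce n₁ n₂ x = z <;> simp [h]
  have s2 : ∀ z, Summable fun x : ℤ × ℤ =>
      φ z * (D.c * τ * (D.b z (reduce n₁ n₂ x) * siegelTerm n₁ n₂ τ u x)) := fun z =>
    ((summable_mul_siegelTerm n₁ n₂ (D.b z) τ u).mul_left _).mul_left _
  calc siegelTheta n₁ n₂ φ σ u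
      = ∑' x, ∑ z, φ z * (if reduce n₁ n₂ x = z then siegelTerm n₁ n₂ σ u x else 0) := by
        refine tsum_congr fun x => ?_
        simp
    _ = ∑ z, ∑' x, φ z * (if reduce n₁ n₂ x = z then siegelTerm n₁ n₂ σ u x else 0) :=
        Summable.tsum_finsetSum fun z _ => s1 z
    _ = ∑ z, ∑' x, φ z * (D.c * τ * (D.b z (reduce n₁ n₂ x) * siegelTerm n₁ n₂ τ u x)) := by
        refine Finset.sum_congr rfl fun z _ => ?_
        rw [tsum_mul_left, hcoset, tsum_mul_left, tsum_mul_left]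
    _ = ∑' x, ∑ z, φ z * (D.c * τ * (D.b z (reduce n₁ n₂ x) * siegelTerm n₁ n₂ τ u x)) :=
        (Summable.tsum_finsetSum fun z _ => s2 z).symm
    _ = _ := by
        rw [siegelTheta, ← tsum_mul_left]
        refine tsum_congr fun x => ?_
        rw [FiniteQuadraticModule.fourier_apply, Finset.mul_sum, Finset.sum_mul, Finset.mul_sum]
        refine Finset.sum_congr rfl fun z _ => ?_
        rw [hb]
        ring

/-- The integral of the Siegel theta kernel over a geodesic segment. -/
noncomputable def thetaIntegral (U : ℝ) (τ : ℍ) : ℂ := ∫ u in -U..U, siegelTheta n₁ n₂ φ τ u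

open ModularGroup in
lemma thetaIntegral_slash_T (U : ℝ) :
    SlashAction.map (1 : ℤ) T (thetaIntegral n₁ n₂ φ U)
      = thetaIntegral n₁ n₂ ((hyperbolicModule n₁ n₂).quad φ) U := by
  ext τ
  rw [ModularForm.SL_slash_apply, modular_T_smul]
  have hT : denom (T : Matrix.SpecialLinearGroup (Fin 2) ℤ) τ = 1 := by
    rw [ModularGroup.denom_apply, ModularGroup.coe_T]
    simp
  rw [hT, one_zpow, mul_one]
  simp_rw [thetaIntegral, siegelTheta_vadd_one]

open ModularGroup in
lemma thetaIntegral_slash_S (U : ℝ) :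
    SlashAction.map (1 : ℤ) S (thetaIntegral n₁ n₂ φ U)
      = thetaIntegral n₁ n₂ ((hyperbolicModule n₁ n₂).fourier φ) U := by
  ext τ
  have hτ := UpperHalfPlane.ne_zero τ
  have hσ : ((S • τ : ℍ) : ℂ) = -1 / τ := by
    rw [modular_S_smul]; simp [neg_div]
  rw [ModularForm.SL_slash_apply, thetaIntegral]
  simp_rw [siegelTheta_inv n₁ n₂ φ hσ]
  rw [intervalIntegral.integral_const_mul, denom_S, zpow_neg, zpow_one, thetaIntegral,
    mul_right_comm, mul_inv_cancel₀ hτ, one_mul]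

lemma isBoundedAtImInfty_thetaIntegral (U : ℝ) :
    IsBoundedAtImInfty (thetaIntegral n₁ n₂ φ U) := by
  obtain ⟨g, hg, h⟩ := exists_norm_mul_siegelTerm_le n₁ n₂ φ |U| one_pos
  rw [isBoundedAtImInfty_iff]
  refine ⟨(∑' x, g x) * |U - -U|, 1, fun τ hτ => ?_⟩
  refine intervalIntegral.norm_integral_le_of_norm_le_const fun u hu => ?_
  have hu' : |u| ≤ |U| := by
    have := Set.uIoc_subset_uIcc hu
    rw [Set.mem_uIcc] at this
    rcases this with h | h
    · exact (abs_le.mpr ⟨h.1, h.2⟩).trans (le_abs_self U)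
    · exact (abs_le.mpr ⟨by linarith, by linarith⟩ : |u| ≤ -U).trans (neg_le_abs U)
  have hs := hg.of_nonneg_of_le (fun x => norm_nonneg _) (h τ hτ u hu')
  exact (norm_tsum_le_tsum_norm hs).trans (hs.tsum_le_tsum (h τ hτ u hu') hg)

end

end

/-! ### From a finite orbit to a modular form on a finite-index subgroup -/

section

open Complex Real
open UpperHalfPlane hiding I
open scoped ModularForm MatrixGroups Manifold

/-- The subgroup of the modular group fixing a function under the slash action. -/
def slashStabilizer (k : ℤ) (f : ℍ → ℂ) : Subgroup SL(2, ℤ) where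
  carrier := {γ | f ∣[k] γ = f}
  mul_mem' {a b} ha hb := by
    change f ∣[k] (a * b) = f
    rw [SlashAction.slash_mul, ha, hb]
  one_mem' := SlashAction.slash_one k f
  inv_mem' {a} ha := by
    change f ∣[k] a⁻¹ = f
    conv_lhs => rw [← show f ∣[k] a = f from ha]
    rw [← SlashAction.slash_mul, mul_inv_cancel, SlashAction.slash_one]

lemma mem_slashStabilizer {k : ℤ} {f : ℍ → ℂ} {γ : SL(2, ℤ)} :
    γ ∈ slashStabilizer k f ↔ f ∣[k] γ = f := Iff.rfl

lemma slash_mem_of_finite {k : ℤ} {X : Set (ℍ → ℂ)} (hX : X.Finite)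
    (hS : ∀ f ∈ X, f ∣[k] ModularGroup.S ∈ X) (hT : ∀ f ∈ X, f ∣[k] ModularGroup.T ∈ X)
    (γ : SL(2, ℤ)) : ∀ f ∈ X, f ∣[k] γ ∈ X := by
  have hγ : γ ∈ Subgroup.closure {ModularGroup.S, ModularGroup.T} := by
    rw [SpecialLinearGroup.SL2Z_generators]; trivial
  induction hγ using Subgroup.closure_induction with
  | mem x hx => rcases hx with rfl | rfl <;> assumption
  | one => intro f hf; rwa [SlashAction.slash_one]
  | mul a b _ _ iha ihb => intro f hf; rw [SlashAction.slash_mul]; exact ihb _ (iha f hf)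
  | inv a _ iha =>
    intro f hf
    have hinj : Set.InjOn (fun g : ℍ → ℂ => g ∣[k] a) X := fun g _ g' _ h => by
      have := congrArg (fun g : ℍ → ℂ => g ∣[k] a⁻¹) h
      simpa only [← SlashAction.slash_mul, mul_inv_cancel, SlashAction.slash_one] using this
    -- An injective self-map of a finite set is onto, so stability under a gives stability under its
    -- inverse.
    have himg : (fun g : ℍ → ℂ => g ∣[k] a) '' X = X :=
      Set.eq_of_subset_of_ncard_le (Set.image_subset_iff.mpr fun g hg => iha g hg)
        hinj.ncard_image.ge hX
    obtain ⟨g, hg, rfl⟩ := himg.ge hf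
    simpa only [← SlashAction.slash_mul, mul_inv_cancel, SlashAction.slash_one] using hg

/-- Left cosets of the stabiliser inject into the finite set X by sending γ to f ∣ γ⁻¹. -/
lemma finiteIndex_slashStabilizer {k : ℤ} {X : Set (ℍ → ℂ)} (hX : X.Finite)
    (h : ∀ γ : SL(2, ℤ), ∀ f ∈ X, f ∣[k] γ ∈ X) {f : ℍ → ℂ} (hf : f ∈ X) :
    (slashStabilizer k f).FiniteIndex := by
  have : Finite X := hX
  let F : SL(2, ℤ) ⧸ slashStabilizer k f → X := Quotient.lift
    (fun γ => (⟨f ∣[k] γ⁻¹, h _ f hf⟩ : X)) fun a b hab => by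
      rw [← Quotient.eq_iff_equiv, QuotientGroup.eq] at hab
      rw [Subtype.mk.injEq]
      have h1 : f ∣[k] (a⁻¹ * b) = f := hab
      conv_rhs => rw [← h1]
      rw [← SlashAction.slash_mul, mul_assoc, mul_inv_cancel, mul_one]
  have hF : Function.Injective F := by
    rintro ⟨a⟩ ⟨b⟩ hab
    refine Quotient.sound ?_
    rw [← Quotient.eq_iff_equiv, QuotientGroup.eq, mem_slashStabilizer]
    have h1 : f ∣[k] a⁻¹ = f ∣[k] b⁻¹ := congrArg Subtype.val hab
    rw [SlashAction.slash_mul, h1, ← SlashAction.slash_mul, inv_mul_cancel, SlashAction.slash_one]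
  have := Finite.of_injective F hF
  exact Subgroup.finiteIndex_of_finite_quotient

/-- The theta integrals of Bφ, with B in the finite Weil monoid, form a finite set stable under S
and T. Boundedness at a cusp reduces to boundedness at i∞ of a translate, which lies in the same
set. -/
theorem exists_modularForm_eq_thetaIntegral (n₁ n₂ : ℕ) [NeZero n₁] [NeZero n₂]
    (φ : ZMod (2 * n₁) × ZMod (2 * n₂) → ℂ) (U : ℝ) {f : ℍ → ℂ} (hf : f = thetaIntegral n₁ n₂ φ U)
    (hol : MDiff f) :
    ∃ Γ : Subgroup SL(2, ℤ), Γ.FiniteIndex ∧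
      ∃ F : ModularForm (Γ.map (Matrix.SpecialLinearGroup.mapGL ℝ)) 1, ∀ τ, F τ = f τ := by
  set D := hyperbolicModule n₁ n₂
  let X : Set (ℍ → ℂ) := (fun B : Module.End ℂ _ => thetaIntegral n₁ n₂ (B φ) U) ''
    (D.weilMonoid : Set (Module.End ℂ (ZMod (2 * n₁) × ZMod (2 * n₂) → ℂ)))
  have hX : X.Finite := D.finite_weilMonoid.image _
  have hstab : ∀ γ : SL(2, ℤ), ∀ g ∈ X, g ∣[(1 : ℤ)] γ ∈ X := by
    refine slash_mem_of_finite hX ?_ ?_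
    · rintro _ ⟨B, hB, rfl⟩
      exact ⟨D.fourier * B, D.weilMonoid.mul_mem (Submonoid.subset_closure (Or.inl rfl)) hB,
        (thetaIntegral_slash_S n₁ n₂ (B φ) U).symm⟩
    · rintro _ ⟨B, hB, rfl⟩
      exact ⟨D.quad * B, D.weilMonoid.mul_mem (Submonoid.subset_closure (Or.inr rfl)) hB,
        (thetaIntegral_slash_T n₁ n₂ (B φ) U).symm⟩
  have hfX : f ∈ X := ⟨1, D.weilMonoid.one_mem, hf.symm⟩
  have hfin := finiteIndex_slashStabilizer hX hstab hfX
  refine ⟨slashStabilizer 1 f, hfin,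
    { toFun := f
      slash_action_eq' := ?_
      holo' := hol
      bdd_at_cusps' := ?_ }, fun τ => rfl⟩
  · rintro _ ⟨γ, hγ, rfl⟩
    exact hγ
  · intro c hc
    rw [Subgroup.IsArithmetic.isCusp_iff_isCusp_SL2Z] at hc
    rw [OnePoint.isBoundedAt_iff_forall_SL2Z hc]
    intro γ _
    obtain ⟨B, -, hB⟩ := hstab γ f hfX
    rw [← hB]
    exact isBoundedAtImInfty_thetaIntegral n₁ n₂ (B φ) U

end

/-! ### Error functions and termwise integration -/

section

open Complex Real
open UpperHalfPlane hiding I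

/-- The error function `2 ∫₀ᶻ exp (-π v²) dv`, with limits `±1` at `±∞`. -/
noncomputable def gaussErr (z : ℝ) : ℝ := 2 * ∫ v in (0 : ℝ)..z, Real.exp (-π * v ^ 2)

lemma continuous_exp_neg_pi_sq : Continuous fun v : ℝ => Real.exp (-π * v ^ 2) := by fun_prop

lemma hasDerivAt_gaussErr (z : ℝ) : HasDerivAt gaussErr (2 * Real.exp (-π * z ^ 2)) z :=
  (continuous_exp_neg_pi_sq.integral_hasStrictDerivAt 0 z).hasDerivAt.const_mul 2

lemma gaussErr_neg (z : ℝ) : gaussErr (-z) = -gaussErr z := by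
  have := intervalIntegral.integral_comp_neg (a := 0) (b := z)
    (fun v : ℝ => Real.exp (-π * v ^ 2))
  simp only [neg_sq, neg_zero] at this
  rw [gaussErr, gaussErr, this, intervalIntegral.integral_symm]
  ring

lemma monotone_gaussErr : Monotone gaussErr :=
  monotone_of_deriv_nonneg (fun z => (hasDerivAt_gaussErr z).differentiableAt) fun z => by
    rw [(hasDerivAt_gaussErr z).deriv]; positivity

lemma tendsto_gaussErr : Filter.Tendsto gaussErr Filter.atTop (nhds 1) := by
  have h := MeasureTheory.intervalIntegral_tendsto_integral_Ioi (μ := MeasureTheory.volume)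
    (0 : ℝ) (integrable_exp_neg_mul_sq pi_pos).integrableOn Filter.tendsto_id
  rw [integral_gaussian_Ioi, div_self pi_ne_zero, Real.sqrt_one] at h
  have h2 := h.const_mul 2
  rw [mul_div_cancel₀ _ (two_ne_zero' ℝ)] at h2
  exact h2

lemma gaussErr_le_one (z : ℝ) : gaussErr z ≤ 1 := monotone_gaussErr.ge_of_tendsto tendsto_gaussErr z

lemma abs_gaussErr_le_one (z : ℝ) : |gaussErr z| ≤ 1 := by
  rw [abs_le]
  have := gaussErr_le_one (-z)
  rw [gaussErr_neg] at this
  exact ⟨by linarith, gaussErr_le_one z⟩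

/-- For v, z ≥ 0 one has (v+z)² ≥ v² + z², so the tail beyond z is at most exp(-πz²) times the full
half-line integral. -/
lemma abs_gaussErr_sub_one_le {z : ℝ} (hz : 0 ≤ z) : |gaussErr z - 1| ≤ Real.exp (-π * z ^ 2) := by
  rw [abs_sub_comm, abs_of_nonneg (by linarith [gaussErr_le_one z])]
  have key : ∀ N : ℝ, 0 ≤ N → gaussErr (z + N) - gaussErr z ≤ Real.exp (-π * z ^ 2) := by
    intro N hN
    have hi : ∀ a b : ℝ, IntervalIntegrable (fun v : ℝ => Real.exp (-π * v ^ 2))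
      MeasureTheory.volume a b := fun a b => continuous_exp_neg_pi_sq.intervalIntegrable a b
    have h1 : gaussErr (z + N) - gaussErr z = 2 * ∫ v in (0 : ℝ)..N, Real.exp (-π * (v + z) ^ 2) := by
      rw [intervalIntegral.integral_comp_add_right (fun v => Real.exp (-π * v ^ 2)), zero_add,
        add_comm N, gaussErr, gaussErr, ← mul_sub,
        intervalIntegral.integral_interval_sub_left (hi _ _) (hi _ _)]
    have h2 : (∫ v in (0 : ℝ)..N, Real.exp (-π * (v + z) ^ 2))
        ≤ ∫ v in (0 : ℝ)..N, Real.exp (-π * z ^ 2) * Real.exp (-π * v ^ 2) := by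
      refine intervalIntegral.integral_mono_on hN (Continuous.intervalIntegrable (by fun_prop) _ _)
        (Continuous.intervalIntegrable (by fun_prop) _ _) fun v hv => ?_
      rw [← Real.exp_add]
      refine Real.exp_le_exp.mpr ?_
      have := mul_nonneg pi_pos.le (mul_nonneg hv.1 hz)
      nlinarith
    rw [intervalIntegral.integral_const_mul] at h2
    have h3 : gaussErr N ≤ 1 := gaussErr_le_one N
    rw [gaussErr] at h3
    have h4 := Real.exp_pos (-π * z ^ 2)
    nlinarith
  refine le_of_tendsto ((tendsto_gaussErr.comp (Filter.tendsto_atTop_add_const_left _ z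
    Filter.tendsto_id)).sub_const (gaussErr z)) ?_
  filter_upwards [Filter.eventually_ge_atTop 0] with N hN using key N hN

/-- A shifted error function approximates the sign of an integer up to a Gaussian error. -/
lemma abs_gaussErr_sub_sg_le {c : ℝ} (hc : 0 < c) (ρ : ℝ) (r : ℤ) :
    |gaussErr (c * (r + ρ)) - sg r| ≤
      2 * Real.exp (π * (c * ρ) ^ 2) * Real.exp (-π * (c * (r + ρ)) ^ 2) := by
  have h1 : (1 : ℝ) ≤ 2 * Real.exp (π * (c * ρ) ^ 2) := by
    have := Real.one_le_exp (x := π * (c * ρ) ^ 2) (by positivity)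
    linarith
  have habs := abs_le.mp (abs_gaussErr_le_one (c * (r + ρ)))
  have hpos := Real.exp_pos (-π * (c * (r + ρ)) ^ 2)
  -- When r and r + ρ disagree in sign, |r + ρ| ≤ |ρ|; the trivial bound 2 then suffices, since the
  -- constant exp(π(cρ)²) outweighs the Gaussian.
  have hfar : (r + ρ) ^ 2 ≤ ρ ^ 2 → |gaussErr (c * (r + ρ)) - sg r| ≤
      2 * Real.exp (π * (c * ρ) ^ 2) * Real.exp (-π * (c * (r + ρ)) ^ 2) := by
    intro h
    have h2 : |gaussErr (c * (r + ρ)) - sg r| ≤ 2 := by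
      rw [sg]; split_ifs <;> rw [abs_le] <;> constructor <;> linarith
    refine h2.trans ?_
    rw [mul_assoc, ← Real.exp_add]
    have := Real.one_le_exp (x := π * (c * ρ) ^ 2 + -π * (c * (r + ρ)) ^ 2) (by
      have : 0 ≤ π * c ^ 2 * (ρ ^ 2 - (r + ρ) ^ 2) := by
        have := sub_nonneg.mpr h
        positivity
      linarith)
    linarith
  by_cases hr : 0 ≤ r
  · have hr' : (0 : ℝ) ≤ r := by exact_mod_cast hr
    by_cases hs : 0 ≤ (r : ℝ) + ρ
    · rw [sg, if_pos hr]
      exact (abs_gaussErr_sub_one_le (mul_nonneg hc.le hs)).trans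
        (le_mul_of_one_le_left hpos.le h1)
    · exact hfar (by nlinarith)
  · have hr' : (r : ℝ) < 0 := by exact_mod_cast not_le.mp hr
    by_cases hs : (r : ℝ) + ρ ≤ 0
    · have := abs_gaussErr_sub_one_le (z := -(c * (r + ρ))) (by nlinarith)
      rw [gaussErr_neg, neg_sq] at this
      rw [sg, if_neg hr, show gaussErr (c * (r + ρ)) - -1 = -(-gaussErr (c * (r + ρ)) - 1) by ring,
        abs_neg]
      exact this.trans (le_mul_of_one_le_left hpos.le h1)
    · exact hfar (by nlinarith)

/-- All dependence on u sits in a real factor, because the difference of the squared coordinates is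
independent of u. -/
lemma siegelTerm_eq (n₁ n₂ : ℕ) (τ : ℍ) (u : ℝ) (x : ℤ × ℤ) :
    siegelTerm n₁ n₂ τ u x = ((√τ.im * posCoord n₁ n₂ u x *
      Real.exp (-π * (2 * √τ.im * negCoord n₁ n₂ u x) ^ 2) : ℝ) : ℂ) *
        qPow τ ((x.1 : ℝ) ^ 2 / (4 * n₁) - (x.2 : ℝ) ^ 2 / (4 * n₂)) := by
  rw [siegelTerm, qPow, ← posCoord_sq_sub n₁ n₂ u x, Complex.ofReal_mul _ (Real.exp _),
    mul_assoc ((√τ.im * posCoord n₁ n₂ u x : ℝ) : ℂ),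
    Complex.ofReal_exp, ← Complex.exp_add, mul_pow, mul_pow, Real.sq_sqrt τ.im_pos.le]
  congr 2
  have h1 : (τ : ℂ) - (starRingEnd ℂ) (τ : ℂ) = 2 * τ.im * I := by
    rw [Complex.sub_conj]; push_cast; rfl
  push_cast
  linear_combination (2 * π * I * (negCoord n₁ n₂ u x : ℂ) ^ 2) * h1
    + (4 * π * τ.im * (negCoord n₁ n₂ u x : ℂ) ^ 2) * I_sq

/-- An antiderivative is `gaussErr` of 2√y · `negCoord`, divided by 4; oddness of `gaussErr` turns
the difference of endpoint values into a sum. -/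
lemma integral_siegelTerm (n₁ n₂ : ℕ) (τ : ℍ) (U : ℝ) (x : ℤ × ℤ) :
    ∫ u in -U..U, siegelTerm n₁ n₂ τ u x =
      ((gaussErr (2 * √τ.im * negCoord n₁ n₂ U x) +
        gaussErr (2 * √τ.im * -negCoord n₁ n₂ (-U) x)) / 4 : ℝ) *
        qPow τ ((x.1 : ℝ) ^ 2 / (4 * n₁) - (x.2 : ℝ) ^ 2 / (4 * n₂)) := by
  simp_rw [siegelTerm_eq]
  rw [intervalIntegral.integral_mul_const, intervalIntegral.integral_ofReal]
  congr 2
  have hd : ∀ u, HasDerivAt (fun u => gaussErr (2 * √τ.im * negCoord n₁ n₂ u x) / 4)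
      (√τ.im * posCoord n₁ n₂ u x * Real.exp (-π * (2 * √τ.im * negCoord n₁ n₂ u x) ^ 2)) u :=
    fun u => by
    refine (((hasDerivAt_gaussErr _).comp u
      ((hasDerivAt_negCoord n₁ n₂ x u).const_mul (2 * √τ.im))).div_const 4).congr_deriv ?_
    ring
  rw [intervalIntegral.integral_eq_sub_of_hasDerivAt (fun u _ => hd u), mul_neg, gaussErr_neg]
  · ring
  · refine Continuous.intervalIntegrable ?_ _ _
    unfold posCoord negCoord
    have := Real.continuous_cosh
    have := Real.continuous_sinh
    fun_prop

lemma hasSum_integral_siegelTerm (n₁ n₂ : ℕ) [NeZero n₁] [NeZero n₂]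
    (φ : ZMod (2 * n₁) × ZMod (2 * n₂) → ℂ) (τ : ℍ) (U : ℝ) :
    HasSum (fun x => φ (reduce n₁ n₂ x) * ∫ u in -U..U, siegelTerm n₁ n₂ τ u x)
      (thetaIntegral n₁ n₂ φ U τ) := by
  obtain ⟨g, hg, h⟩ := exists_norm_mul_siegelTerm_le n₁ n₂ φ |U| τ.im_pos
  have hu : ∀ u ∈ Set.uIoc (-U) U, |u| ≤ |U| := fun u hu => by
    have := Set.uIoc_subset_uIcc hu
    rw [Set.mem_uIcc] at this
    rcases this with h | h
    · exact (abs_le.mpr ⟨h.1, h.2⟩).trans (le_abs_self U)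
    · exact (abs_le.mpr ⟨by linarith, by linarith⟩ : |u| ≤ -U).trans (neg_le_abs U)
  have := intervalIntegral.hasSum_integral_of_dominated_convergence (μ := MeasureTheory.volume)
    (a := -U) (b := U) (F := fun x u => φ (reduce n₁ n₂ x) * siegelTerm n₁ n₂ τ u x)
    (f := siegelTheta n₁ n₂ φ τ) (fun x _ => g x)
    (fun x => ((continuous_siegelTerm n₁ n₂ τ x).const_mul _).aestronglyMeasurable)
    (fun x => .of_forall fun u hu' => h τ le_rfl u (hu u hu') x)
    (.of_forall fun _ _ => hg) intervalIntegrable_const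
    (.of_forall fun u _ => (summable_mul_siegelTerm n₁ n₂ φ τ u).hasSum)
  simp_rw [intervalIntegral.integral_const_mul] at this
  exact this

end

/-! ### Convergence and holomorphy of the theta series; the two reflections -/

section

open Complex Real
open UpperHalfPlane hiding I
open scoped Manifold

lemma sgPair_eq_zero_of_mul_neg {r s : ℤ} (h : r * s < 0) : sgPair r s = 0 := by
  unfold sgPair sg
  rcases mul_neg_iff.mp h with ⟨hr, hs⟩ | ⟨hr, hs⟩
  · rw [if_pos hr.le, if_neg hs.not_ge]; norm_num
  · rw [if_neg hr.not_ge, if_pos hs.le]; norm_num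

lemma abs_sgPair_le (r s : ℤ) : |sgPair r s| ≤ 1 := by
  unfold sgPair sg
  split_ifs <;> norm_num

/-- The form is indefinite, but where the sign factor can be nonzero one has rs ≥ 0, and the mixed
term only helps. -/
lemma le_thetaExponent {t : ℕ} (ht : 1 ≤ t) (p m : ℤ) {r s : ℤ} (h : 0 ≤ r * s) :
    ((r : ℝ) ^ 2 + (s : ℝ) ^ 2) / 8 - (|(p : ℝ)| + |(m : ℝ)|) / 2 * (|(r : ℝ)| + |(s : ℝ)|)
      ≤ thetaExponent t p m r s := by
  have ht' : (1 : ℝ) ≤ t := by exact_mod_cast ht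
  have h' : (0 : ℝ) ≤ r * s := by exact_mod_cast h
  have h1 : 0 ≤ (4 * (t : ℝ) - 1) / 4 * r * s := by
    rw [mul_assoc]; exact mul_nonneg (by linarith) h'
  have h2 : -(((|(p : ℝ)| + |(m : ℝ)|) / 2) * |(r : ℝ)|) ≤ ((p : ℝ) + m) / 2 * r := by
    refine neg_le_of_abs_le ?_
    rw [abs_mul, abs_div, abs_two]
    gcongr
    exact abs_add_le _ _
  have h3 : -(((|(p : ℝ)| + |(m : ℝ)|) / 2) * |(s : ℝ)|) ≤ ((p : ℝ) - m) / 2 * s := by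
    refine neg_le_of_abs_le ?_
    rw [abs_mul, abs_div, abs_two]
    gcongr
    exact abs_sub _ _
  unfold thetaExponent
  linarith

/-- The term of the theta series as a function of a complex variable. -/
noncomputable def thetaTermC (t : ℕ) (p m : ℤ) (x : ThetaIndex) (z : ℂ) : ℂ :=
  (sgPair x.1.1 x.1.2 : ℂ) * (-1 : ℂ) ^ ((x.1.1 - x.1.2 - 1) / 2)
    * cexp (2 * π * I * (thetaExponent t p m x.1.1 x.1.2 : ℂ) * z)

/-- The upper bound Y on the imaginary part controls the linear terms of the exponent, which may be
negative. -/
lemma exists_norm_thetaTermC_le {t : ℕ} (ht : 1 ≤ t) (p m : ℤ) {y : ℝ} (hy : 0 < y) (Y : ℝ) :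
    ∃ g : ThetaIndex → ℝ, Summable g ∧ ∀ x, ∀ z : ℂ, y ≤ z.im → z.im ≤ Y →
      ‖thetaTermC t p m x z‖ ≤ g x := by
  have hc : 0 < π * y / 4 := by positivity
  set S := (|(p : ℝ)| + |(m : ℝ)|) / 2 with hS
  have hS0 : 0 ≤ S := by positivity
  refine ⟨_, (summable_exp_neg_sq_add_abs hc (2 * π * Y * S)).comp_injective
    (i := fun x : ThetaIndex => x.1) Subtype.val_injective, fun x z hz hzY => ?_⟩
  have hz0 : 0 < z.im := hy.trans_le hz
  obtain ⟨⟨r, s⟩, hx⟩ := x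
  simp only [thetaTermC, Function.comp_apply]
  rw [norm_mul, norm_mul, norm_zpow, norm_neg, norm_one, one_zpow, mul_one, Complex.norm_real,
    Real.norm_eq_abs]
  by_cases hrs : r * s < 0
  · rw [sgPair_eq_zero_of_mul_neg hrs, abs_zero, zero_mul]
    exact (Real.exp_pos _).le
  · refine (mul_le_of_le_one_left (norm_nonneg _) (abs_sgPair_le r s)).trans ?_
    rw [Complex.norm_exp]
    refine Real.exp_le_exp.mpr ?_
    have hE := le_thetaExponent ht p m (not_lt.mp hrs)
    rw [← hS] at hE
    set E := thetaExponent t p m r s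
    have hre : (2 * π * I * (E : ℂ) * z).re = -(2 * π * (z.im * E)) := by
      simp; ring
    rw [hre]
    have h1 := mul_le_mul_of_nonneg_left hE hz0.le
    have h2 : y * (((r : ℝ) ^ 2 + (s : ℝ) ^ 2) / 8) ≤ z.im * (((r : ℝ) ^ 2 + (s : ℝ) ^ 2) / 8) := by
      gcongr
    have h3 : z.im * (S * (|(r : ℝ)| + |(s : ℝ)|)) ≤ Y * (S * (|(r : ℝ)| + |(s : ℝ)|)) := by
      gcongr
    rw [mul_sub] at h1
    have h4 := mul_le_mul_of_nonneg_left (h2.trans ((sub_le_iff_le_add.mp h1).trans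
      (add_le_add le_rfl h3))) (by positivity : 0 ≤ 2 * π)
    linarith

lemma summable_norm_thetaTerm {t : ℕ} (ht : 1 ≤ t) (p m : ℤ) (τ : ℍ) :
    Summable fun x => ‖thetaTerm t p m τ x‖ := by
  obtain ⟨g, hg, h⟩ := exists_norm_thetaTermC_le ht p m τ.im_pos τ.im
  exact hg.of_nonneg_of_le (fun _ => norm_nonneg _) fun x => h x τ le_rfl le_rfl

lemma mdifferentiable_thetaStar {t : ℕ} (ht : 1 ≤ t) (p m : ℤ) : MDiff (thetaStar t p m) := by
  rw [UpperHalfPlane.mdifferentiable_iff]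
  set c := -((m : ℝ) ^ 2 / (2 * (2 * (t : ℝ) - 1))) + (p : ℝ) ^ 2 / (4 * (t : ℝ)) with hc
  have hd : DifferentiableOn ℂ (fun z => cexp (2 * π * I * (c : ℂ) * z) *
      ∑' x, thetaTermC t p m x z) {z | 0 < z.im} := by
    refine DifferentiableOn.mul (Differentiable.differentiableOn (by fun_prop)) ?_
    intro z hz
    have hz' : 0 < z.im := hz
    obtain ⟨g, hg, h⟩ := exists_norm_thetaTermC_le ht p m (half_pos hz') (z.im + 1)
    have hopen : IsOpen {w : ℂ | z.im / 2 < w.im ∧ w.im < z.im + 1} :=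
      (isOpen_lt continuous_const Complex.continuous_im).inter
        (isOpen_lt Complex.continuous_im continuous_const)
    have := differentiableOn_tsum_of_summable_norm hg (F := fun x z => thetaTermC t p m x z)
      (fun x => Differentiable.differentiableOn (by unfold thetaTermC; fun_prop)) hopen
      (fun x w hw => h x w hw.1.le hw.2.le)
    exact (this.differentiableAt (hopen.mem_nhds ⟨by linarith, by linarith⟩)).differentiableWithinAt
  refine hd.congr fun z hz => ?_
  rw [Function.comp_apply, ofComplex_apply_of_im_pos hz]
  rfl

section Completion

variable (t : ℕ) (p m : ℤ)

/-- The sign of a term of the theta series. -/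
noncomputable def thetaSign (x : ThetaIndex) : ℂ := (-1 : ℂ) ^ ((x.1.1 - x.1.2 - 1) / 2)

/-- The diagonalising coordinates. -/
def thetaVec (x : ThetaIndex) : ℤ × ℤ :=
  (t * (x.1.1 + x.1.2) + p, (2 * t - 1) * (x.1.1 - x.1.2) - 2 * m)

/-- The normalised exponent. -/
noncomputable def starExponent (x : ThetaIndex) : ℝ :=
  ((thetaVec t p m x).1 : ℝ) ^ 2 / (4 * t) - ((thetaVec t p m x).2 : ℝ) ^ 2 / (4 * (4 * t - 2))

variable {t}

lemma starExponent_eq (ht : 1 ≤ t) (x : ThetaIndex) : starExponent t p m x =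
    -((m : ℝ) ^ 2 / (2 * (2 * (t : ℝ) - 1))) + (p : ℝ) ^ 2 / (4 * (t : ℝ))
      + thetaExponent t p m x.1.1 x.1.2 := by
  have ht' : (1 : ℝ) ≤ t := by exact_mod_cast ht
  have h1 : (t : ℝ) ≠ 0 := by linarith
  have h2 : 2 * (t : ℝ) - 1 ≠ 0 := by linarith
  have e1 : ∀ a : ℝ, (t * a + p) ^ 2 / (4 * t) = t * a ^ 2 / 4 + p * a / 2 + p ^ 2 / (4 * t) :=
    fun a => by field_simp; ring
  have e2 : ∀ w d : ℝ, w ≠ 0 → (w * d - 2 * m) ^ 2 / (4 * (2 * w)) =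
      w * d ^ 2 / 8 - m * d / 2 + m ^ 2 / (2 * w) := fun w d hw => by field_simp; ring
  rw [starExponent, thetaVec, thetaExponent, show 4 * (t : ℝ) - 2 = 2 * (2 * t - 1) by ring]
  push_cast
  rw [e1, e2 _ _ h2]
  ring

lemma hasSum_thetaStar (ht : 1 ≤ t) (τ : ℍ) :
    HasSum (fun x : ThetaIndex => (sgPair x.1.1 x.1.2 : ℂ) *
      (thetaSign x * qPow τ (starExponent t p m x))) (thetaStar t p m τ) := by
  refine ((summable_norm_thetaTerm ht p m τ).of_norm.hasSum.mul_left _).congr_fun fun x => ?_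
  rw [starExponent_eq p m ht, thetaTerm, thetaSign]
  have : ∀ a b : ℝ, qPow τ (a + b) = qPow τ a * qPow τ b := fun a b => by
    rw [qPow, qPow, qPow, ← Complex.exp_add]; congr 1; push_cast; ring
  rw [this _ (thetaExponent t p m x.1.1 x.1.2)]
  ring

lemma odd_sub (x : ThetaIndex) : Odd (x.1.1 - x.1.2) := by
  have h := x.2
  rw [Int.modEq_iff_dvd] at h
  rw [← Int.not_even_iff_odd]
  intro he
  exact h (by have := he.two_dvd; omega)

lemma thetaSign_eq_neg {x y : ThetaIndex} {k : ℤ} (hk : Odd k)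
    (h : y.1.1 - y.1.2 = x.1.1 - x.1.2 + 2 * k) : thetaSign y = -thetaSign x := by
  have e : (y.1.1 - y.1.2 - 1) / 2 = (x.1.1 - x.1.2 - 1) / 2 + k := by omega
  rw [thetaSign, thetaSign, e, zpow_add₀ (by norm_num), hk.neg_one_zpow, mul_neg_one]

variable (t)

/-- The reflection of the plane fixing the first coordinate and preserving the exponent. -/
def reflectSnd : ThetaIndex ≃ ThetaIndex :=
  Function.Involutive.toPerm
    (fun x => ⟨(x.1.1, -x.1.2 - 2 * (4 * t - 1) * x.1.1 - 4 * (p - m)), by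
      have h := odd_sub x
      rw [Int.modEq_iff_dvd]
      intro hd
      rw [← Int.not_even_iff_odd] at h
      refine h (even_iff_two_dvd.mpr ?_)
      have h2 : (x.1.1 - x.1.2) = (-x.1.2 - 2 * (4 * t - 1) * x.1.1 - 4 * (p - m) - x.1.1)
        + 2 * (x.1.1 + (4 * t - 1) * x.1.1 + 2 * (p - m)) := by ring
      rw [h2]
      exact dvd_add hd (dvd_mul_right _ _)⟩)
    (fun x => by
      refine Subtype.ext (Prod.ext rfl ?_)
      simp only
      ring)

/-- The reflection of the plane fixing the second coordinate and preserving the exponent. -/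
def reflectFst : ThetaIndex ≃ ThetaIndex :=
  Function.Involutive.toPerm
    (fun x => ⟨(-x.1.1 - 2 * (4 * t - 1) * x.1.2 - 4 * (p + m), x.1.2), by
      have h := odd_sub x
      rw [Int.modEq_iff_dvd]
      intro hd
      rw [← Int.not_even_iff_odd] at h
      refine h (even_iff_two_dvd.mpr ?_)
      have h2 : (x.1.1 - x.1.2) = (x.1.2 - (-x.1.1 - 2 * (4 * t - 1) * x.1.2 - 4 * (p + m)))
        + 2 * (-(4 * t) * x.1.2 - 2 * (p + m)) := by ring
      rw [h2]
      exact dvd_add hd (dvd_mul_right _ _)⟩)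
    (fun x => by
      refine Subtype.ext (Prod.ext ?_ rfl)
      simp only
      ring)

lemma reflectSnd_val (x : ThetaIndex) : (reflectSnd t p m x).1 =
    (x.1.1, -x.1.2 - 2 * (4 * t - 1) * x.1.1 - 4 * (p - m)) := rfl

lemma reflectFst_val (x : ThetaIndex) : (reflectFst t p m x).1 =
    (-x.1.1 - 2 * (4 * t - 1) * x.1.2 - 4 * (p + m), x.1.2) := rfl

/-- The reflection changes r - s by 2k with k ≡ r + s (mod 2), and r + s is odd. -/
lemma thetaSign_reflectSnd (x : ThetaIndex) : thetaSign (reflectSnd t p m x) = -thetaSign x := by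
  obtain ⟨j, hj⟩ := odd_sub x
  refine thetaSign_eq_neg (k := x.1.2 + (4 * t - 1) * x.1.1 + 2 * (p - m))
    ⟨-j + 2 * t * x.1.1 - 1 + (p - m), ?_⟩ ?_
  · have : x.1.2 = x.1.1 - (2 * j + 1) := by linarith
    rw [this]; ring
  · rw [reflectSnd_val]; ring

lemma thetaSign_reflectFst (x : ThetaIndex) : thetaSign (reflectFst t p m x) = -thetaSign x := by
  obtain ⟨j, hj⟩ := odd_sub x
  refine thetaSign_eq_neg (k := -x.1.1 - (4 * t - 1) * x.1.2 - 2 * (p + m))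
    ⟨-j - 2 * t * x.1.2 - 1 - (p + m), ?_⟩ ?_
  · have : x.1.1 = x.1.2 + (2 * j + 1) := by linarith
    rw [this]; ring
  · rw [reflectFst_val]; ring

variable {t}

/-- For fixed r the exponent is a quadratic polynomial in s; the reflection exchanges the two values
of s at which it takes the same value. -/
lemma starExponent_reflectSnd (ht : 1 ≤ t) (x : ThetaIndex) :
    starExponent t p m (reflectSnd t p m x) = starExponent t p m x := by
  rw [starExponent_eq p m ht, starExponent_eq p m ht, reflectSnd_val, thetaExponent, thetaExponent]
  push_cast
  ring

lemma starExponent_reflectFst (ht : 1 ≤ t) (x : ThetaIndex) :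
    starExponent t p m (reflectFst t p m x) = starExponent t p m x := by
  rw [starExponent_eq p m ht, starExponent_eq p m ht, reflectFst_val, thetaExponent, thetaExponent]
  push_cast
  ring

lemma tsum_eq_zero_of_equiv_neg {ι : Type*} (e : ι ≃ ι) {f : ι → ℂ} (h : ∀ x, f (e x) = -f x) :
    ∑' x, f x = 0 := by
  have h1 := e.tsum_eq f
  simp_rw [h, tsum_neg] at h1
  exact self_eq_neg.mp h1.symm

/-- No growth condition on G is needed: the reflection argument gives the value 0 of `tsum` with or
without summability. -/
lemma tsum_fst_eq_zero (ht : 1 ≤ t) (τ : ℍ) (G : ℤ → ℂ) :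
    ∑' x : ThetaIndex, G x.1.1 * (thetaSign x * qPow τ (starExponent t p m x)) = 0 :=
  tsum_eq_zero_of_equiv_neg (reflectSnd t p m) fun x => by
    rw [thetaSign_reflectSnd, starExponent_reflectSnd p m ht, reflectSnd_val]; ring

lemma tsum_snd_eq_zero (ht : 1 ≤ t) (τ : ℍ) (G : ℤ → ℂ) :
    ∑' x : ThetaIndex, G x.1.2 * (thetaSign x * qPow τ (starExponent t p m x)) = 0 :=
  tsum_eq_zero_of_equiv_neg (reflectFst t p m) fun x => by
    rw [thetaSign_reflectFst, starExponent_reflectFst p m ht, reflectFst_val]; ring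

end Completion

end

/-! ### Identification of the theta series with a theta integral -/

section

open Complex Real
open UpperHalfPlane hiding I
open scoped Manifold

section Identification

variable {t n₂ : ℕ} (ht : 1 ≤ t) (hn : n₂ + 2 = 4 * t) (p m : ℤ)

/-- The half-length of the geodesic segment cut out by the cone of summation. -/
noncomputable def halfLength (t : ℕ) : ℝ := Real.arsinh √(2 * (t : ℝ) - 1)

/-- Here sinh U = √(2t-1) and cosh U = √(2t). This U makes the negative coordinates at the two ends
proportional to k/t ± l/(2t-1), which for k, l from `thetaVec` are 2r and 2s up to constants. -/
lemma negCoord_eq {t n₂ : ℕ} (ht : 1 ≤ t) (hn : n₂ + 2 = 4 * t) (x : ℤ × ℤ) :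
    negCoord t n₂ (halfLength t) x
        = √t * √(2 * t - 1) * ((x.1 : ℝ) / t + (x.2 : ℝ) / (2 * t - 1)) / 2 ∧
      -negCoord t n₂ (-halfLength t) x
        = √t * √(2 * t - 1) * ((x.1 : ℝ) / t - (x.2 : ℝ) / (2 * t - 1)) / 2 := by
  have ht' : (1 : ℝ) ≤ t := by exact_mod_cast ht
  have hw : (0 : ℝ) < 2 * t - 1 := by linarith
  have hn' : (n₂ : ℝ) = 2 * (2 * t - 1) := by
    have : (n₂ : ℝ) + 2 = 4 * t := by exact_mod_cast hn
    linarith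
  have hc : Real.cosh (halfLength t) = √2 * √t := by
    rw [halfLength, Real.cosh_arsinh, Real.sq_sqrt hw.le, ← Real.sqrt_mul zero_le_two]
    ring_nf
  have hs : Real.sinh (halfLength t) = √(2 * t - 1) := Real.sinh_arsinh _
  rw [negCoord, negCoord, Real.cosh_neg, Real.sinh_neg, hc, hs, scale, scale, hn',
    Real.sqrt_mul zero_le_two]
  have ha : 0 < √(t : ℝ) := Real.sqrt_pos.mpr (by linarith)
  have hb : 0 < √(2 * (t : ℝ) - 1) := Real.sqrt_pos.mpr hw
  have ha2 : (t : ℝ) = √(t : ℝ) ^ 2 := (Real.sq_sqrt (by linarith)).symm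
  have hb2 : 2 * (t : ℝ) - 1 = √(2 * (t : ℝ) - 1) ^ 2 := (Real.sq_sqrt hw.le).symm
  have hd : 0 < √(2 : ℝ) := Real.sqrt_pos.mpr two_pos
  have key1 : ∀ a b d k l : ℝ, 0 < a → 0 < b → 0 < d →
      1 / (2 * a) * k * b + 1 / (2 * (d * b)) * l * (d * a)
        = a * b * (k / a ^ 2 + l / b ^ 2) / 2 := by
    intro a b d k l ha hb hd; field_simp
  have key2 : ∀ a b d k l : ℝ, 0 < a → 0 < b → 0 < d →
      -(1 / (2 * a) * k * -b + 1 / (2 * (d * b)) * l * (d * a))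
        = a * b * (k / a ^ 2 - l / b ^ 2) / 2 := by
    intro a b d k l ha hb hd; field_simp; ring
  constructor
  · rw [key1 _ _ _ _ _ ha hb hd, ← ha2, ← hb2]
  · rw [key2 _ _ _ _ _ ha hb hd, ← ha2, ← hb2]

include ht hn

lemma negCoord_thetaVec (x : ThetaIndex) : negCoord t n₂ (halfLength t) (thetaVec t p m x)
    = √t * √(2 * t - 1) * (x.1.1 + ((p : ℝ) / t - 2 * m / (2 * t - 1)) / 2) := by
  have ht' : (1 : ℝ) ≤ t := by exact_mod_cast ht
  have h1 : (t : ℝ) ≠ 0 := by linarith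
  have h2 : 2 * (t : ℝ) - 1 ≠ 0 := by linarith
  have e1 : ∀ w d : ℝ, w ≠ 0 → (w * d - 2 * m) / w = d - 2 * m / w := fun w d hw => by field_simp
  have e2 : ∀ w d : ℝ, w ≠ 0 → (w * d + p) / w = d + p / w := fun w d hw => by field_simp
  rw [(negCoord_eq ht hn _).1, thetaVec]
  push_cast
  rw [e1 _ _ h2, e2 _ _ h1]
  ring

lemma neg_negCoord_thetaVec (x : ThetaIndex) : -negCoord t n₂ (-halfLength t) (thetaVec t p m x)
    = √t * √(2 * t - 1) * (x.1.2 + ((p : ℝ) / t + 2 * m / (2 * t - 1)) / 2) := by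
  have ht' : (1 : ℝ) ≤ t := by exact_mod_cast ht
  have h1 : (t : ℝ) ≠ 0 := by linarith
  have h2 : 2 * (t : ℝ) - 1 ≠ 0 := by linarith
  have e1 : ∀ w d : ℝ, w ≠ 0 → (w * d - 2 * m) / w = d - 2 * m / w := fun w d hw => by field_simp
  have e2 : ∀ w d : ℝ, w ≠ 0 → (w * d + p) / w = d + p / w := fun w d hw => by field_simp
  rw [(negCoord_eq ht hn _).2, thetaVec]
  push_cast
  rw [e1 _ _ h2, e2 _ _ h1]
  ring

omit hn in
lemma thetaVec_injective : Function.Injective (thetaVec t p m) := by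
  rintro ⟨⟨a, b⟩, _⟩ ⟨⟨c, d⟩, _⟩ h
  simp only [thetaVec, Prod.mk.injEq, add_left_inj, sub_left_inj] at h
  have h1 := mul_left_cancel₀ (by omega : (t : ℤ) ≠ 0) h.1
  have h2 := mul_left_cancel₀ (by omega : 2 * (t : ℤ) - 1 ≠ 0) h.2
  exact Subtype.ext (Prod.ext (by simp only; omega) (by simp only; omega))

omit ht hn in
variable (t n₂) in
/-- The function on the discriminant group that selects the terms of the theta series. -/
def thetaFunction (z : ZMod (2 * t) × ZMod (2 * n₂)) : ℂ :=
  if z.1 = ((p + t : ℤ) : ZMod (2 * t)) then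
    (if z.2 = ((2 * t - 1 - 2 * m : ℤ) : ZMod (2 * n₂)) then 1 else 0) -
      (if z.2 = ((-(2 * t - 1) - 2 * m : ℤ) : ZMod (2 * n₂)) then 1 else 0)
  else 0

omit ht in
lemma thetaFunction_thetaVec (x : ThetaIndex) :
    thetaFunction t n₂ p m (reduce t n₂ (thetaVec t p m x)) = thetaSign x := by
  obtain ⟨j, hj⟩ := odd_sub x
  have hcast : ((2 * n₂ : ℕ) : ℤ) = (2 * t - 1) * 4 := by omega
  have hcast1 : ((2 * t : ℕ) : ℤ) = t * 2 := by push_cast; ring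
  have hw : (2 * (t : ℤ) - 1) ≠ 0 := by omega
  rw [thetaFunction, reduce, thetaVec, if_pos]
  · simp only [ZMod.intCast_eq_intCast_iff_dvd_sub, hcast, hj]
    -- With r - s = 2j + 1, the modulus 2n₂ = 4(2t-1) detects r - s modulo 4, that is, the parity of
    -- j.
    have e1 : 2 * (t : ℤ) - 1 - 2 * m - ((2 * t - 1) * (2 * j + 1) - 2 * m)
        = (2 * t - 1) * (-(2 * j)) := by ring
    have e2 : -(2 * (t : ℤ) - 1) - 2 * m - ((2 * t - 1) * (2 * j + 1) - 2 * m)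
        = (2 * t - 1) * (-(2 * j + 2)) := by ring
    simp only [e1, e2, mul_dvd_mul_iff_left hw]
    rw [thetaSign, hj, show (2 * j + 1 - 1) / 2 = j by omega]
    rcases Int.even_or_odd j with hj' | hj'
    · rw [hj'.neg_one_zpow, if_pos, if_neg, sub_zero] <;> obtain ⟨i, rfl⟩ := hj' <;> omega
    · rw [hj'.neg_one_zpow, if_neg, if_pos, zero_sub] <;> obtain ⟨i, rfl⟩ := hj' <;> omega
  · simp only [ZMod.intCast_eq_intCast_iff_dvd_sub, hcast1]
    have e : p + (t : ℤ) - (t * (x.1.1 + x.1.2) + p) = t * (1 - (x.1.1 + x.1.2)) := by ring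
    rw [e]
    exact mul_dvd_mul_left _ (by omega)

omit ht in
lemma mem_range_thetaVec {v : ℤ × ℤ} (hv : thetaFunction t n₂ p m (reduce t n₂ v) ≠ 0) :
    v ∈ Set.range (thetaVec t p m) := by
  have hcast : ((2 * n₂ : ℕ) : ℤ) = (2 * t - 1) * 4 := by omega
  have hcast1 : ((2 * t : ℕ) : ℤ) = t * 2 := by push_cast; ring
  rw [thetaFunction, reduce] at hv
  simp only [ZMod.intCast_eq_intCast_iff_dvd_sub, hcast, hcast1] at hv
  split_ifs at hv with h1 h2 h3 h3
  · obtain ⟨a, ha⟩ := h1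
    obtain ⟨b, hb⟩ := h2
    -- Solves r + s = 1 - 2a and r - s = 1 - 4b; in the last nonzero case the second equation
    -- becomes r - s = -1 - 4b.
    refine ⟨⟨(1 - a - 2 * b, -a + 2 * b), ?_⟩, Prod.ext ?_ ?_⟩
    · rw [Int.modEq_iff_dvd]; simp only; omega
    · simp only [thetaVec]; linarith
    · simp only [thetaVec]; linarith
  · obtain ⟨a, ha⟩ := h1
    obtain ⟨b, hb⟩ := h2
    refine ⟨⟨(1 - a - 2 * b, -a + 2 * b), ?_⟩, Prod.ext ?_ ?_⟩
    · rw [Int.modEq_iff_dvd]; simp only; omega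
    · simp only [thetaVec]; linarith
    · simp only [thetaVec]; linarith
  · obtain ⟨a, ha⟩ := h1
    obtain ⟨b, hb⟩ := h3
    refine ⟨⟨(-a - 2 * b, 1 - a + 2 * b), ?_⟩, Prod.ext ?_ ?_⟩
    · rw [Int.modEq_iff_dvd]; simp only; omega
    · simp only [thetaVec]; linarith
    · simp only [thetaVec]; linarith
  · exact absurd (sub_zero (0 : ℂ)) hv
  · exact absurd rfl hv

/-- With a, b the positive and negative coordinates at U, a term of the q-series has size
exp(-2πy(a²-b²)). The Gaussian exp(-4πyb²) in the error turns this into the convergent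
exp(-2πy(a²+b²)). -/
lemma summable_error [NeZero t] [NeZero n₂] (τ : ℍ) {G : ThetaIndex → ℝ} {C : ℝ}
    (hG : ∀ x, |G x| ≤ C * Real.exp (-π * (2 * √τ.im *
      negCoord t n₂ (halfLength t) (thetaVec t p m x)) ^ 2)) :
    Summable fun x => (G x : ℂ) * (thetaSign x * qPow τ (starExponent t p m x)) := by
  have hn' : (n₂ : ℝ) = 4 * t - 2 := by
    have : (n₂ : ℝ) + 2 = 4 * t := by exact_mod_cast hn
    linarith
  have hy := τ.im_pos
  set U := halfLength t
  set μ := min (scale t ^ 2) (scale n₂ ^ 2) with hμ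
  have hμ0 : 0 < μ := lt_min (pow_pos (scale_pos t) 2) (pow_pos (scale_pos n₂) 2)
  have hc : 0 < 2 * π * τ.im * (Real.exp (-(2 * |U|)) * μ) := by positivity
  refine (((summable_exp_neg_sq_add_abs hc 0).comp_injective
    (thetaVec_injective ht p m)).mul_left C).of_norm_bounded fun x => ?_
  set a := posCoord t n₂ U (thetaVec t p m x) with ha
  set b := negCoord t n₂ U (thetaVec t p m x) with hb
  have hE : starExponent t p m x = a ^ 2 - b ^ 2 := by
    rw [ha, hb, posCoord_sq_sub, starExponent, hn']
  have hC : 0 ≤ C := by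
    have := (abs_nonneg _).trans (hG x)
    exact nonneg_of_mul_nonneg_left this (Real.exp_pos _)
  have hq : ‖thetaSign x * qPow τ (starExponent t p m x)‖
      = Real.exp (-(2 * π * τ.im * (a ^ 2 - b ^ 2))) := by
    rw [norm_mul, thetaSign, norm_zpow, norm_neg, norm_one, one_zpow, one_mul, qPow,
      Complex.norm_exp, hE]
    congr 1
    simp [-Complex.ofReal_sub, -Complex.ofReal_pow]
    ring
  rw [norm_mul, hq, Complex.norm_real, Real.norm_eq_abs]
  refine (mul_le_mul_of_nonneg_right (hG x) (Real.exp_pos _).le).trans ?_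
  rw [mul_assoc, ← Real.exp_add]
  refine mul_le_mul_of_nonneg_left (Real.exp_le_exp.mpr ?_) hC
  have h4 := le_posCoord_sq_add t n₂ (le_refl |U|) (thetaVec t p m x)
  rw [← ha, ← hb] at h4
  set k := ((thetaVec t p m x).1 : ℝ)
  set l := ((thetaVec t p m x).2 : ℝ)
  have h5 : μ * (k ^ 2 + l ^ 2) ≤ scale t ^ 2 * k ^ 2 + scale n₂ ^ 2 * l ^ 2 := by
    rw [mul_add]
    gcongr
    · exact min_le_left _ _
    · exact min_le_right _ _
  have h6 : Real.exp (-(2 * |U|)) * μ * (k ^ 2 + l ^ 2) ≤ a ^ 2 + b ^ 2 := by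
    rw [mul_assoc]
    exact (mul_le_mul_of_nonneg_left h5 (Real.exp_pos _).le).trans h4
  have h7 := mul_le_mul_of_nonneg_left h6 (by positivity : 0 ≤ 2 * π * τ.im)
  rw [mul_pow, mul_pow, Real.sq_sqrt hy.le]
  linarith

/-- The factor 2 on `thetaFunction` reconciles the denominator 4 in `integral_siegelTerm` with the
denominator 2 in `sgPair`. -/
theorem thetaStar_eq_thetaIntegral [NeZero t] [NeZero n₂] :
    thetaStar t p m
      = thetaIntegral t n₂ (fun z => 2 * thetaFunction t n₂ p m z) (halfLength t) := by
  ext τ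
  have ht' : (1 : ℝ) ≤ t := by exact_mod_cast ht
  have hn' : (n₂ : ℝ) = 4 * t - 2 := by
    have : (n₂ : ℝ) + 2 = 4 * t := by exact_mod_cast hn
    linarith
  have hy := τ.im_pos
  set c := 2 * √τ.im * (√t * √(2 * t - 1)) with hc
  have hc0 : 0 < c := by
    have h1 : 0 < √(t : ℝ) := Real.sqrt_pos.mpr (by linarith)
    have h2 : 0 < √(2 * (t : ℝ) - 1) := Real.sqrt_pos.mpr (by linarith)
    have h3 := Real.sqrt_pos.mpr hy
    positivity
  set ρ₁ := ((p : ℝ) / t - 2 * m / (2 * t - 1)) / 2 with hρ₁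
  set ρ₂ := ((p : ℝ) / t + 2 * m / (2 * t - 1)) / 2 with hρ₂
  let H : ThetaIndex → ℂ := fun x => thetaSign x * qPow τ (starExponent t p m x)
  have hI : HasSum (fun x : ThetaIndex =>
      ((gaussErr (c * (x.1.1 + ρ₁)) + gaussErr (c * (x.1.2 + ρ₂))) / 2 : ℝ) * H x)
      (thetaIntegral t n₂ (fun z => 2 * thetaFunction t n₂ p m z) (halfLength t) τ) := by
    have h := hasSum_integral_siegelTerm t n₂ (fun z => 2 * thetaFunction t n₂ p m z) τ
      (halfLength t)
    rw [← (thetaVec_injective ht p m).hasSum_iff] at h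
    · refine h.congr_fun fun x => ?_
      rw [Function.comp_apply, thetaFunction_thetaVec hn, integral_siegelTerm,
        negCoord_thetaVec ht hn, neg_negCoord_thetaVec ht hn, hn',
        ← mul_assoc (2 * √τ.im) (√t * √(2 * t - 1)),
        ← mul_assoc (2 * √τ.im) (√t * √(2 * t - 1)), ← hc, ← hρ₁, ← hρ₂]
      change _ * (thetaSign x * qPow τ (starExponent t p m x)) = _
      rw [starExponent]
      push_cast
      ring
    · intro v hv
      by_contra hne
      refine hv (mem_range_thetaVec hn p m fun h0 => hne ?_)
      simp only [h0, mul_zero, zero_mul]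
  have hS := hasSum_thetaStar p m ht τ
  -- The difference of the two series is a sum of an r-error and an s-error. Convergence of the
  -- r-error is what allows the `tsum` to be split, after which the reflections annihilate each
  -- part.
  have hG1 : Summable fun x : ThetaIndex =>
      (((gaussErr (c * (x.1.1 + ρ₁)) - sg x.1.1) / 2 : ℝ) : ℂ) * H x := by
    refine summable_error ht hn p m τ (C := Real.exp (π * (c * ρ₁) ^ 2)) fun x => ?_
    rw [negCoord_thetaVec ht hn, ← mul_assoc, ← hc, ← hρ₁, abs_div, abs_two, div_le_iff₀ two_pos]
    refine (abs_gaussErr_sub_sg_le hc0 ρ₁ x.1.1).trans (le_of_eq ?_)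
    ring
  have hD := hI.sub hS
  have hG2 := hD.summable.sub hG1
  have e2 : ∀ x : ThetaIndex, ((gaussErr (c * (x.1.1 + ρ₁)) + gaussErr (c * (x.1.2 + ρ₂))) / 2 : ℝ)
      * H x - (sgPair x.1.1 x.1.2 : ℂ) * H x
      - (((gaussErr (c * (x.1.1 + ρ₁)) - sg x.1.1) / 2 : ℝ) : ℂ) * H x
      = (((gaussErr (c * (x.1.2 + ρ₂)) - sg x.1.2) / 2 : ℝ) : ℂ) * H x := fun x => by
    rw [sgPair]; push_cast; ring
  have h0 := hD.summable.tsum_sub hG1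
  rw [hD.tsum_eq] at h0
  have z1 := tsum_fst_eq_zero p m ht τ
    fun r => (((gaussErr (c * (r + ρ₁)) - sg r) / 2 : ℝ) : ℂ)
  have z2 := tsum_snd_eq_zero p m ht τ
    fun r => (((gaussErr (c * (r + ρ₂)) - sg r) / 2 : ℝ) : ℂ)
  rw [tsum_congr e2, show (∑' x : ThetaIndex, _) = (0 : ℂ) from z2,
    show (∑' x : ThetaIndex, _) = (0 : ℂ) from z1, sub_zero] at h0
  exact (sub_eq_zero.mp h0.symm).symm

end Identification

end

theorem mainTheorem7 (t : ℕ) (ht : 1 ≤ t) (p m : ℤ) :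
    (∀ τ : UpperHalfPlane, Summable (fun x : ThetaIndex => ‖thetaTerm t p m τ x‖)) ∧
    ∃ Γ : Subgroup (Matrix.SpecialLinearGroup (Fin 2) ℤ), Γ.FiniteIndex ∧
      ∃ F : ModularForm (Γ.map (Matrix.SpecialLinearGroup.mapGL ℝ)) 1,
        ∀ τ : UpperHalfPlane, F τ = thetaStar t p m τ := by
  refine ⟨summable_norm_thetaTerm ht p m, ?_⟩
  have h1 : NeZero t := ⟨by omega⟩
  have h2 : NeZero (4 * t - 2) := ⟨by omega⟩
  exact exists_modularForm_eq_thetaIntegral t (4 * t - 2) _ _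
    (thetaStar_eq_thetaIntegral ht (by omega) p m) (mdifferentiable_thetaStar ht p m)
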